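/- For a set $S\subset\mathbb{R}^n$ and $p,q\in S$ let $d_l^S(p,q)\in[0,\infty]$ be the infimum of the lengths of the rectifiable paths in $S$ from $p$ to $q$ (with $d_l^S(p,q)=\infty$ if there is none). The set $S$ is called *Lipschitz normally embedded* (LNE) if there is $C>0$ such that $d_l^S(p,q)\le C\|p-q\|$ for all $p,q\in S$. The *medial axis* $M_X$ of a closed nonempty set $X\subset\mathbb{R}^n$ is the set of those points of $\mathbb{R}^n\setminus X$ that have more than one closest point in $X$. In $\mathbb{R}^3$ consider the curves $$\gamma_{11}=\{(x,y,0): 0\le x\le 1,\ y=\sqrt{x}\},\qquad \gamma_{12}=\{(x,y,0): 0\le x\le \tfrac12,\ y=2\sqrt{x}\},$$ $$\gamma_{21}=\{(x,y,0): -1\le x\le 0,\ y=\sqrt{-x}\},\qquad \gamma_{22}=\{(x,y,0): -\tfrac12\le x\le 0,\ y=2\sqrt{-x}\}.$$ For $i=1,2$ let the horn $X_i$ be the union, over $y_0\in[0,1]$, of the circles in the planes $\{y=y_0\}$ that have as a diameter the segment joining the point of $\gamma_{i1}$ and the point of $\gamma_{i2}$ in that plane (a single point for $y_0=0$), and let $H_i$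 be the union of the open discs in these planes bounded by these circles. Let $$X_3=\{(x,y,0): -\tfrac12\le x\le\tfrac12,\ 0\le y\le 1,\ |y|>2\sqrt{|x|}\},\qquad X=X_1\cup X_2\cup X_3 .$$ Then $X$ is LNE, but its medial axis is not: neither $M_X$ nor its closure $\overline{M_X}$ is LNE, and $\overline{M_X}\cap B(0,r)$ is not LNE for any $r>0$, where $B(0,r)$ is the open ball. Moreover, the parts $M_X\cap H_1$ and $M_X\cap H_2$ of the medial axis inside the two horns meet only at the origin, that is, $\overline{M_X\cap H_1}\cap\overline{M_X\cap H_2}=\{0\}$, and they are tangent there to order greater than one: there are $\alpha>1$ and $C>0$ such that $\|p-q\|\le C\|p\|^{\alpha}$ for all $p\in M_X\cap H_1$ and $q\in M_X\cap H_2$ with $\|p\|=\|q\|$. -/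

import Mathlib

/-- Three-dimensional Euclidean space; for a point `p` the coordinates `x`, `y`, `z` are
`p 0`, `p 1`, `p 2`. -/
abbrev E3 : Type := EuclideanSpace ℝ (Fin 3)

/-- The length (inner) distance on `X`: the infimum of the lengths of the rectifiable paths in `X`
from `x` to `y` (and `∞` if there is no such path). -/
noncomputable def innerEDist {E : Type*} [PseudoEMetricSpace E] (X : Set E) (x y : E) : ENNReal :=
  ⨅ (γ : Path x y) (_ : Set.range γ ⊆ X) (_ : BoundedVariationOn γ Set.univ),
    eVariationOn γ Set.univ

/-- Lipschitz normally embedded sets: the length distance is bounded by a constant multiple of the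
induced distance. -/
def IsLNE {E : Type*} [PseudoEMetricSpace E] (X : Set E) : Prop :=
  ∃ C : ℝ, 0 < C ∧ ∀ x ∈ X, ∀ y ∈ X, innerEDist X x y ≤ ENNReal.ofReal C * edist x y

/-- The set `m(x)` of the points of `X` that are closest to `x`. -/
def closestPoints {E : Type*} [PseudoMetricSpace E] (X : Set E) (x : E) : Set E :=
  {y | y ∈ X ∧ dist y x = Metric.infDist x X}

/-- The medial axis of `X`: the points outside `X` with more than one closest point in `X`. -/
def medialAxis {E : Type*} [PseudoMetricSpace E] (X : Set E) : Set E :=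
  {x | x ∉ X ∧ 1 < (closestPoints X x).encard}

/-- `y = √x`, `0 ≤ x ≤ 1`, `z = 0`. -/
def gamma11 : Set E3 :=
  {p | p 0 ∈ Set.Icc (0 : ℝ) 1 ∧ 0 ≤ p 1 ∧ p 2 = 0 ∧ p 1 = Real.sqrt (p 0)}

/-- `y = 2√x`, `0 ≤ x ≤ 1/2`, `z = 0`. -/
def gamma12 : Set E3 :=
  {p | p 0 ∈ Set.Icc (0 : ℝ) (1 / 2) ∧ 0 ≤ p 1 ∧ p 2 = 0 ∧ p 1 = 2 * Real.sqrt (p 0)}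

/-- `y = √(-x)`, `-1 ≤ x ≤ 0`, `z = 0`. -/
def gamma21 : Set E3 :=
  {p | p 0 ∈ Set.Icc (-1 : ℝ) 0 ∧ 0 ≤ p 1 ∧ p 2 = 0 ∧ p 1 = Real.sqrt (-p 0)}

/-- `y = 2√(-x)`, `-1/2 ≤ x ≤ 0`, `z = 0`. -/
def gamma22 : Set E3 :=
  {p | p 0 ∈ Set.Icc (-(1 / 2) : ℝ) 0 ∧ 0 ≤ p 1 ∧ p 2 = 0 ∧ p 1 = 2 * Real.sqrt (-p 0)}

/-- The horn over a pair of curves: in each plane `y = const` with `0 ≤ y ≤ 1`, the circle one of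
whose diameters joins the point of `γ` and the point of `γ'` in this plane. -/
def horn (γ γ' : Set E3) : Set E3 :=
  {p | p 1 ∈ Set.Icc (0 : ℝ) 1 ∧ ∃ a ∈ γ, ∃ b ∈ γ', a 1 = p 1 ∧ b 1 = p 1 ∧
    ‖midpoint ℝ a b - b‖ = ‖midpoint ℝ a b - p‖}

/-- The region enclosed by the horn over a pair of curves: the open discs bounded by its circles. -/
def hornInside (γ γ' : Set E3) : Set E3 :=
  {p | p 1 ∈ Set.Icc (0 : ℝ) 1 ∧ ∃ a ∈ γ, ∃ b ∈ γ', a 1 = p 1 ∧ b 1 = p 1 ∧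
    ‖midpoint ℝ a b - p‖ < ‖midpoint ℝ a b - b‖}

/-- The planar wall between the two horns. -/
def wall : Set E3 :=
  {p | p 0 ∈ Set.Icc (-(1 / 2) : ℝ) (1 / 2) ∧ p 1 ∈ Set.Icc (0 : ℝ) 1 ∧ p 2 = 0 ∧
    2 * Real.sqrt |p 0| < |p 1|}

/-- The union of the two horns and the wall. -/
def hornsWithWall : Set E3 := horn gamma11 gamma12 ∪ horn gamma21 gamma22 ∪ wall

/-! ### Coordinates -/

/-! For `0 ≤ y ≤ 1` the horns are the zero sets of the polynomials `hornForm s`, `s = ±1`, which are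
homogeneous of degree 4 when `x, y, z` have weights 2, 1, 2. So the set `X` is a union of parabolic
arcs issuing from the origin.

`X` is LNE because `p` can slide down its arc to the height of a lower point `q` with speed at most
5 (`dist_slide_le`), and each horizontal section, two circles joined by a segment, is LNE with one
constant (`innerEDist_le_of_same_height`).

The medial axis fails to be LNE near the origin. At every height `0 < y ≤ 1` it has a point inside
the right horn (`exists_mem_medialAxis_inside`), whose mirror image lies in the left horn at
distance at most `2 y ^ 2`. Away from the origin and the upper rim the horn is a smooth surface of
locally positive reach, so the inner part of the medial axis does not accumulate there
(`dist_ge_of_mem_medialAxis_inside`, by Lagrange multipliers and a quadratic remainder bound). Hence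
a path in the closure that leaves the horn visits the origin or the height 1, and for `y ≤ 1 / 2`
its length is at least `y`, which is not `O(y ^ 2)`.

The statements on tangency use only the horns' interiors: these lie in `|x|, |z| ≤ y ^ 2`, on
opposite sides of the plane `x = 0`. -/

theorem E3.norm_sq (v : E3) : ‖v‖ ^ 2 = v 0 ^ 2 + v 1 ^ 2 + v 2 ^ 2 := by
  rw [EuclideanSpace.real_norm_sq_eq, Fin.sum_univ_three]

theorem E3.dist_sq (p q : E3) :
    dist p q ^ 2 = (p 0 - q 0) ^ 2 + (p 1 - q 1) ^ 2 + (p 2 - q 2) ^ 2 := by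
  rw [dist_eq_norm, E3.norm_sq]
  simp

theorem E3.dist_le {p q : E3} {c : ℝ} (hc : 0 ≤ c)
    (h : (p 0 - q 0) ^ 2 + (p 1 - q 1) ^ 2 + (p 2 - q 2) ^ 2 ≤ c ^ 2) : dist p q ≤ c :=
  abs_le_of_sq_le_sq' (by rwa [E3.dist_sq]) hc |>.2

theorem E3.dist_le_add_abs (p q : E3) :
    dist p q ≤ |p 0 - q 0| + |p 1 - q 1| + |p 2 - q 2| := by
  apply E3.dist_le (by positivity)
  have h0 := sq_abs (p 0 - q 0)
  have h1 := sq_abs (p 1 - q 1)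
  have h2 := sq_abs (p 2 - q 2)
  have := abs_nonneg (p 0 - q 0)
  have := abs_nonneg (p 1 - q 1)
  have := abs_nonneg (p 2 - q 2)
  nlinarith [mul_nonneg (abs_nonneg (p 0 - q 0)) (abs_nonneg (p 1 - q 1)),
    mul_nonneg (abs_nonneg (p 0 - q 0)) (abs_nonneg (p 2 - q 2)),
    mul_nonneg (abs_nonneg (p 1 - q 1)) (abs_nonneg (p 2 - q 2))]

theorem E3.abs_sub_le_dist (p q : E3) (i : Fin 3) : |p i - q i| ≤ dist p q := by
  apply abs_le_of_sq_le_sq _ dist_nonneg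
  rw [E3.dist_sq]
  fin_cases i <;> simp <;> nlinarith [sq_nonneg (p 0 - q 0), sq_nonneg (p 1 - q 1),
    sq_nonneg (p 2 - q 2)]

theorem E3.ext {p q : E3} (h0 : p 0 = q 0) (h1 : p 1 = q 1) (h2 : p 2 = q 2) : p = q := by
  ext i
  fin_cases i <;> assumption

theorem E3.continuous_coord (i : Fin 3) : Continuous fun p : E3 => p i :=
  (EuclideanSpace.proj (𝕜 := ℝ) i).continuous

/-- The polynomial whose zero set in `0 ≤ y ≤ 1` is the right horn (`s = 1`) or the left horn
(`s = -1`), and which is negative inside the horn. -/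
noncomputable def hornForm (s : ℝ) (p : E3) : ℝ :=
  p 0 ^ 2 + p 2 ^ 2 - s * (5 / 4) * p 0 * p 1 ^ 2 + p 1 ^ 4 / 4

theorem continuous_hornForm (s : ℝ) : Continuous (hornForm s) := by
  have := E3.continuous_coord
  unfold hornForm
  fun_prop

/-- The points `a` of a curve that is a parabola `x = c y²` in the plane `z = 0`, for
`0 ≤ y ≤ 1`. -/
def IsParabola (γ : Set E3) (c : ℝ) : Prop :=
  ∀ a : E3, a 1 ∈ Set.Icc (0 : ℝ) 1 → (a ∈ γ ↔ a 0 = c * a 1 ^ 2 ∧ a 2 = 0)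

theorem isParabola_gamma11 : IsParabola gamma11 1 := by
  rintro a ⟨h0, h1⟩
  constructor
  · rintro ⟨⟨hx, -⟩, -, hz, hy⟩
    rw [hy, Real.sq_sqrt hx]
    exact ⟨(one_mul _).symm, hz⟩
  · rintro ⟨hx, hz⟩
    refine ⟨⟨?_, ?_⟩, h0, hz, ?_⟩
    · rw [hx]; positivity
    · rw [hx]; nlinarith
    · rw [hx, one_mul, Real.sqrt_sq h0]

theorem isParabola_gamma12 : IsParabola gamma12 (1 / 4) := by
  rintro a ⟨h0, h1⟩
  constructor
  · rintro ⟨⟨hx, -⟩, -, hz, hy⟩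
    rw [hy, mul_pow, Real.sq_sqrt hx]
    exact ⟨by ring, hz⟩
  · rintro ⟨hx, hz⟩
    refine ⟨⟨?_, ?_⟩, h0, hz, ?_⟩
    · rw [hx]; positivity
    · rw [hx]; nlinarith
    · rw [hx, show 1 / 4 * a 1 ^ 2 = (a 1 / 2) ^ 2 by ring, Real.sqrt_sq (by positivity)]; ring

theorem isParabola_gamma21 : IsParabola gamma21 (-1) := by
  rintro a ⟨h0, h1⟩
  constructor
  · rintro ⟨⟨-, hx⟩, -, hz, hy⟩
    rw [hy, Real.sq_sqrt (by linarith)]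
    exact ⟨by ring, hz⟩
  · rintro ⟨hx, hz⟩
    refine ⟨⟨?_, ?_⟩, h0, hz, ?_⟩
    · rw [hx]; nlinarith
    · rw [hx]; nlinarith
    · rw [hx, show -(-1 * a 1 ^ 2) = (a 1) ^ 2 by ring, Real.sqrt_sq h0]

theorem isParabola_gamma22 : IsParabola gamma22 (-(1 / 4)) := by
  rintro a ⟨h0, h1⟩
  constructor
  · rintro ⟨⟨-, hx⟩, -, hz, hy⟩
    rw [hy, mul_pow, Real.sq_sqrt (by linarith)]
    exact ⟨by ring, hz⟩
  · rintro ⟨hx, hz⟩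
    refine ⟨⟨?_, ?_⟩, h0, hz, ?_⟩
    · rw [hx]; nlinarith
    · rw [hx]; nlinarith
    · rw [hx, show -(-(1 / 4) * a 1 ^ 2) = (a 1 / 2) ^ 2 by ring, Real.sqrt_sq (by positivity)]
      ring

theorem norm_midpoint_sub_sq (a b p : E3) : ‖midpoint ℝ a b - p‖ ^ 2 =
    ((a 0 + b 0) / 2 - p 0) ^ 2 + ((a 1 + b 1) / 2 - p 1) ^ 2 + ((a 2 + b 2) / 2 - p 2) ^ 2 := by
  rw [E3.norm_sq]
  simp only [midpoint_eq_smul_add, PiLp.sub_apply, PiLp.smul_apply, PiLp.add_apply, smul_eq_mul,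
    invOf_eq_inv]
  ring

/-- A plane of constant height meets each parabola in exactly one point, so the existential
quantifiers can be evaluated. -/
theorem exists_parabola_points_iff {γ γ' : Set E3} {c c' : ℝ} (h : IsParabola γ c)
    (h' : IsParabola γ' c') {p : E3} (hp : p 1 ∈ Set.Icc (0 : ℝ) 1) (P : E3 → E3 → Prop) :
    (∃ a ∈ γ, ∃ b ∈ γ', a 1 = p 1 ∧ b 1 = p 1 ∧ P a b) ↔
      P !₂[c * p 1 ^ 2, p 1, 0] !₂[c' * p 1 ^ 2, p 1, 0] := by
  constructor
  · rintro ⟨a, ha, b, hb, ha1, hb1, hP⟩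
    obtain ⟨ha0, ha2⟩ := (h a (by rwa [ha1])).1 ha
    obtain ⟨hb0, hb2⟩ := (h' b (by rwa [hb1])).1 hb
    rw [ha1] at ha0
    rw [hb1] at hb0
    have ea : a = !₂[c * p 1 ^ 2, p 1, 0] := E3.ext (by simp [ha0]) (by simp [ha1]) (by simp [ha2])
    have eb : b = !₂[c' * p 1 ^ 2, p 1, 0] := E3.ext (by simp [hb0]) (by simp [hb1]) (by simp [hb2])
    rwa [ea, eb] at hP
  · intro hP
    exact ⟨_, (h _ (by simpa using hp)).2 (by simp), _, (h' _ (by simpa using hp)).2 (by simp),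
      by simp, by simp, hP⟩

theorem mem_horn_iff {γ γ' : Set E3} {c c' : ℝ} (h : IsParabola γ c) (h' : IsParabola γ' c')
    (p : E3) : p ∈ horn γ γ' ↔ p 1 ∈ Set.Icc (0 : ℝ) 1 ∧
      (p 0 - c * p 1 ^ 2) * (p 0 - c' * p 1 ^ 2) + p 2 ^ 2 = 0 := by
  refine and_congr_right fun hp => ?_
  rw [exists_parabola_points_iff h h' hp fun a b => ‖midpoint ℝ a b - b‖ = ‖midpoint ℝ a b - p‖,
    ← sq_eq_sq₀ (norm_nonneg _) (norm_nonneg _), norm_midpoint_sub_sq, norm_midpoint_sub_sq]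
  simp only [Matrix.cons_val]
  constructor <;> intro hh <;> nlinarith

theorem mem_hornInside_iff {γ γ' : Set E3} {c c' : ℝ} (h : IsParabola γ c)
    (h' : IsParabola γ' c') (p : E3) : p ∈ hornInside γ γ' ↔ p 1 ∈ Set.Icc (0 : ℝ) 1 ∧
      (p 0 - c * p 1 ^ 2) * (p 0 - c' * p 1 ^ 2) + p 2 ^ 2 < 0 := by
  refine and_congr_right fun hp => ?_
  rw [exists_parabola_points_iff h h' hp fun a b => ‖midpoint ℝ a b - p‖ < ‖midpoint ℝ a b - b‖,
    ← sq_lt_sq₀ (norm_nonneg _) (norm_nonneg _), norm_midpoint_sub_sq, norm_midpoint_sub_sq]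
  simp only [Matrix.cons_val]
  constructor <;> intro hh <;> nlinarith

theorem mem_horn_right_iff (p : E3) :
    p ∈ horn gamma11 gamma12 ↔ p 1 ∈ Set.Icc (0 : ℝ) 1 ∧ hornForm 1 p = 0 := by
  rw [mem_horn_iff isParabola_gamma11 isParabola_gamma12, hornForm]
  ring_nf

theorem mem_horn_left_iff (p : E3) :
    p ∈ horn gamma21 gamma22 ↔ p 1 ∈ Set.Icc (0 : ℝ) 1 ∧ hornForm (-1) p = 0 := by
  rw [mem_horn_iff isParabola_gamma21 isParabola_gamma22, hornForm]
  ring_nf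

theorem mem_hornInside_right_iff (p : E3) :
    p ∈ hornInside gamma11 gamma12 ↔ p 1 ∈ Set.Icc (0 : ℝ) 1 ∧ hornForm 1 p < 0 := by
  rw [mem_hornInside_iff isParabola_gamma11 isParabola_gamma12, hornForm]
  ring_nf

theorem mem_hornInside_left_iff (p : E3) :
    p ∈ hornInside gamma21 gamma22 ↔ p 1 ∈ Set.Icc (0 : ℝ) 1 ∧ hornForm (-1) p < 0 := by
  rw [mem_hornInside_iff isParabola_gamma21 isParabola_gamma22, hornForm]
  ring_nf

theorem mem_wall_iff (p : E3) :
    p ∈ wall ↔ p 1 ∈ Set.Icc (0 : ℝ) 1 ∧ p 2 = 0 ∧ |p 0| < p 1 ^ 2 / 4 := by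
  have key : p 1 ∈ Set.Icc (0 : ℝ) 1 →
      (2 * Real.sqrt |p 0| < |p 1| ↔ |p 0| < p 1 ^ 2 / 4) := by
    rintro ⟨h0, -⟩
    rw [abs_of_nonneg h0, ← lt_div_iff₀' two_pos, ← sq_lt_sq₀ (Real.sqrt_nonneg _) (by positivity),
      Real.sq_sqrt (abs_nonneg _), div_pow]
    norm_num
  constructor
  · rintro ⟨-, hy, hz, h⟩
    exact ⟨hy, hz, (key hy).1 h⟩
  · rintro ⟨hy, hz, h⟩
    refine ⟨?_, hy, hz, (key hy).2 h⟩
    have := abs_lt.1 h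
    constructor <;> nlinarith [hy.1, hy.2]

theorem mem_hornsWithWall_iff (p : E3) : p ∈ hornsWithWall ↔ p 1 ∈ Set.Icc (0 : ℝ) 1 ∧
    (hornForm 1 p = 0 ∨ hornForm (-1) p = 0 ∨ (p 2 = 0 ∧ |p 0| ≤ p 1 ^ 2 / 4)) := by
  simp only [hornsWithWall, Set.mem_union, mem_horn_right_iff, mem_horn_left_iff, mem_wall_iff]
  constructor
  · rintro ((h | h) | h)
    · exact ⟨h.1, Or.inl h.2⟩
    · exact ⟨h.1, Or.inr (Or.inl h.2)⟩
    · exact ⟨h.1, Or.inr (Or.inr ⟨h.2.1, h.2.2.le⟩)⟩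
  · rintro ⟨hy, h | h | ⟨hz, h⟩⟩
    · exact Or.inl (Or.inl ⟨hy, h⟩)
    · exact Or.inl (Or.inr ⟨hy, h⟩)
    · rcases h.lt_or_eq with h | h
      · exact Or.inr ⟨hy, hz, h⟩
      · rcases abs_choice (p 0) with h' | h'
        · refine Or.inl (Or.inl ⟨hy, ?_⟩)
          rw [h'] at h
          rw [hornForm, hz, h]
          ring
        · refine Or.inl (Or.inr ⟨hy, ?_⟩)
          rw [h'] at h
          rw [hornForm, hz, show p 0 = -(p 1 ^ 2 / 4) by linarith]
          ring

theorem isClosed_hornsWithWall : IsClosed hornsWithWall := by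
  have hc := E3.continuous_coord
  have h1 := continuous_hornForm 1
  have h2 := continuous_hornForm (-1)
  have : hornsWithWall = {p : E3 | p 1 ∈ Set.Icc (0 : ℝ) 1 ∧
    (hornForm 1 p = 0 ∨ hornForm (-1) p = 0 ∨ (p 2 = 0 ∧ |p 0| ≤ p 1 ^ 2 / 4))} :=
    Set.ext mem_hornsWithWall_iff
  rw [this]
  refine (isClosed_Icc.preimage (hc 1)).inter ((isClosed_eq h1 continuous_const).union
    ((isClosed_eq h2 continuous_const).union ((isClosed_eq (hc 2) continuous_const).inter ?_)))
  exact isClosed_le (hc 0).abs (((hc 1).pow 2).div_const 4)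

/-- No part of `X` enters the right horn: the left horn has `x ≤ 0`, and on the wall `x` is at most
the smaller root of `(x - y ^ 2) * (x - y ^ 2 / 4)`. -/
theorem hornForm_one_nonneg {p : E3} (hp : p ∈ hornsWithWall) : 0 ≤ hornForm 1 p := by
  obtain ⟨⟨h0, h1⟩, h | h | ⟨hz, h⟩⟩ := (mem_hornsWithWall_iff p).1 hp
  · exact h.ge
  · unfold hornForm at *
    have : p 0 * p 1 ^ 2 ≤ 0 := by
      nlinarith [sq_nonneg (p 0), sq_nonneg (p 2), sq_nonneg (p 1 ^ 2)]
    linarith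
  · rw [hornForm, hz]
    obtain ⟨h2, h3⟩ := abs_le.1 h
    nlinarith [mul_nonneg (sub_nonneg.2 h3) (by nlinarith : 0 ≤ p 1 ^ 2 - p 0)]

/-- Inside and on either horn, the distance to the axis `x = z = 0` is at most `y²`. -/
theorem abs_le_sq_of_hornForm_nonpos {s : ℝ} (hs : s ^ 2 = 1) {p : E3} (h : hornForm s p ≤ 0) :
    p 1 ^ 2 / 4 ≤ s * p 0 ∧ s * p 0 ≤ p 1 ^ 2 ∧ p 2 ^ 2 ≤ (3 / 8 * p 1 ^ 2) ^ 2 := by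
  -- In factored form, a nonpositive value puts `s * p 0` between the two roots; completing the
  -- square bounds `p 2`.
  have h' : (s * p 0 - p 1 ^ 2) * (s * p 0 - p 1 ^ 2 / 4) + p 2 ^ 2 ≤ 0 := by
    unfold hornForm at h
    have : s ^ 2 * p 0 ^ 2 = p 0 ^ 2 := by rw [hs, one_mul]
    nlinarith
  have := sq_nonneg (p 1)
  have := sq_nonneg (p 2)
  refine ⟨?_, ?_, ?_⟩
  · by_contra! hh
    nlinarith
  · by_contra! hh
    nlinarith
  · nlinarith [sq_nonneg (s * p 0 - 5 / 8 * p 1 ^ 2)]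

theorem abs_le_sq_of_mem_hornsWithWall {p : E3} (hp : p ∈ hornsWithWall) :
    |p 0| ≤ p 1 ^ 2 ∧ |p 2| ≤ p 1 ^ 2 := by
  obtain ⟨-, h | h | ⟨hz, h⟩⟩ := (mem_hornsWithWall_iff p).1 hp
  · obtain ⟨h1, h2, h3⟩ := abs_le_sq_of_hornForm_nonpos (by norm_num) h.le
    have := abs_le_of_sq_le_sq' h3 (by positivity)
    exact ⟨abs_le.2 ⟨by nlinarith, by nlinarith⟩, abs_le.2 ⟨by nlinarith, by nlinarith⟩⟩
  · obtain ⟨h1, h2, h3⟩ := abs_le_sq_of_hornForm_nonpos (by norm_num) h.le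
    have := abs_le_of_sq_le_sq' h3 (by positivity)
    exact ⟨abs_le.2 ⟨by nlinarith, by nlinarith⟩, abs_le.2 ⟨by nlinarith, by nlinarith⟩⟩
  · exact ⟨h.trans (by nlinarith [sq_nonneg (p 1)]), by rw [hz, abs_zero]; positivity⟩

/-! ### The length distance -/

theorem innerEDist_le_eVariationOn {E : Type*} [PseudoEMetricSpace E] {X : Set E} {x y : E}
    (γ : Path x y) (hX : Set.range γ ⊆ X) : innerEDist X x y ≤ eVariationOn γ Set.univ := by
  by_cases h : BoundedVariationOn γ Set.univ
  · exact iInf_le_of_le γ (iInf_le_of_le hX (iInf_le_of_le h le_rfl))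
  · rw [BoundedVariationOn, ne_eq, not_not] at h
    rw [h]
    exact le_top

theorem innerEDist_le_symm {E : Type*} [PseudoEMetricSpace E] (X : Set E) (x y : E) :
    innerEDist X x y ≤ innerEDist X y x := by
  refine le_iInf fun γ => le_iInf fun hγ => le_iInf fun _ => ?_
  refine (innerEDist_le_eVariationOn γ.symm (by rwa [Path.symm_range])).trans ?_
  exact eVariationOn.comp_le_of_antitoneOn γ unitInterval.symm
    (fun a _ b _ hab => unitInterval.symm_le_symm.2 hab) (fun _ _ => Set.mem_univ _)

theorem innerEDist_comm {E : Type*} [PseudoEMetricSpace E] (X : Set E) (x y : E) :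
    innerEDist X x y = innerEDist X y x :=
  (innerEDist_le_symm X x y).antisymm (innerEDist_le_symm X y x)

theorem eVariationOn_trans_le {E : Type*} [PseudoEMetricSpace E] {x y z : E} (γ : Path x y)
    (γ' : Path y z) : eVariationOn (γ.trans γ') Set.univ ≤
      eVariationOn γ Set.univ + eVariationOn γ' Set.univ := by
  set f : ℝ → E := fun t => if t ≤ 1 / 2 then γ.extend (2 * t) else γ'.extend (2 * t - 1) with hf
  have hle : eVariationOn (γ.trans γ') Set.univ ≤ eVariationOn f (Set.Icc 0 1) :=
    eVariationOn.comp_le_of_monotoneOn f (Subtype.val : unitInterval → ℝ)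
      (fun _ _ _ _ h => h) (fun t _ => t.2)
  refine hle.trans ?_
  have hsplit := eVariationOn.Icc_add_Icc f (s := Set.univ) (a := 0) (b := 1 / 2) (c := 1)
    (by norm_num) (by norm_num) (Set.mem_univ _)
  simp only [Set.univ_inter] at hsplit
  rw [← hsplit]
  refine add_le_add ?_ ?_
  · have : Set.EqOn f (γ ∘ fun t => Set.projIcc 0 1 zero_le_one (2 * t)) (Set.Icc 0 (1 / 2)) := by
      intro t ht
      simp only [hf, if_pos ht.2]
      rfl
    rw [eVariationOn.eq_of_eqOn this]
    refine eVariationOn.comp_le_of_monotoneOn _ _ (fun a _ b _ hab => ?_)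
      fun _ _ => Set.mem_univ _
    exact Set.monotone_projIcc _ (by linarith)
  · have : Set.EqOn f (γ' ∘ fun t => Set.projIcc 0 1 zero_le_one (2 * t - 1))
        (Set.Icc (1 / 2) 1) := by
      intro t ht
      -- At the junction `t = 1 / 2` the definition of `f` takes the first branch, but both branches
      -- have the value `y` there.
      rcases ht.1.eq_or_lt with h | h
      · subst h
        simp [hf]
      · simp only [hf, if_neg (not_le.2 h)]
        rfl
    rw [eVariationOn.eq_of_eqOn this]
    refine eVariationOn.comp_le_of_monotoneOn _ _ (fun a _ b _ hab => ?_)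
      fun _ _ => Set.mem_univ _
    exact Set.monotone_projIcc _ (by linarith)

theorem innerEDist_triangle {E : Type*} [PseudoEMetricSpace E] (X : Set E) (x y z : E) :
    innerEDist X x z ≤ innerEDist X x y + innerEDist X y z := by
  rw [innerEDist, innerEDist, innerEDist]
  simp only [ENNReal.iInf_add, ENNReal.add_iInf]
  refine le_iInf fun γ' => le_iInf fun hγ' => le_iInf fun _ => le_iInf fun γ => le_iInf fun hγ =>
    le_iInf fun _ => ?_
  refine le_trans (innerEDist_le_eVariationOn (γ.trans γ') ?_) (eVariationOn_trans_le γ γ')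
  rw [Path.trans_range]
  exact Set.union_subset hγ hγ'

/-- Every explicit path below is fed through this bound; `Set.uIcc` allows the parameter to run in
either direction. -/
theorem innerEDist_le_of_dist_le {E : Type*} [PseudoMetricSpace E] {X : Set E} {a b K : ℝ}
    (f : ℝ → E) (hf : ∀ s ∈ Set.uIcc a b, ∀ t ∈ Set.uIcc a b, dist (f s) (f t) ≤ K * |s - t|)
    (hX : ∀ t ∈ Set.uIcc a b, f t ∈ X) :
    innerEDist X (f a) (f b) ≤ ENNReal.ofReal (K * |a - b|) := by
  have hφ : ∀ t ∈ Set.Icc (0 : ℝ) 1, a + t * (b - a) ∈ Set.uIcc a b := by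
    rintro t ⟨h0, h1⟩
    rw [Set.mem_uIcc]
    rcases le_total a b with h | h
    · exact Or.inl ⟨by nlinarith, by nlinarith⟩
    · exact Or.inr ⟨by nlinarith, by nlinarith⟩
  have hK0 : 0 ≤ K * |a - b| :=
    dist_nonneg.trans (hf a Set.left_mem_uIcc b Set.right_mem_uIcc)
  set g : ℝ → E := fun t => f (a + t * (b - a)) with hg
  have hlip : LipschitzOnWith (Real.toNNReal (K * |a - b|)) g (Set.Icc 0 1) := by
    refine LipschitzOnWith.of_dist_le_mul fun s hs t ht => ?_
    rw [Real.coe_toNNReal _ hK0, Real.dist_eq]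
    refine (hf _ (hφ s hs) _ (hφ t ht)).trans_eq ?_
    rw [show a + s * (b - a) - (a + t * (b - a)) = (s - t) * (b - a) by ring, abs_mul,
      abs_sub_comm b a]
    ring
  let γ : Path (f a) (f b) :=
    { toFun := fun t => g t
      continuous_toFun := continuousOn_iff_continuous_domRestrict.1 hlip.continuousOn
      source' := by simp [hg]
      target' := by simp [hg] }
  refine (innerEDist_le_eVariationOn γ ?_).trans ?_
  · rintro _ ⟨t, rfl⟩
    exact hX _ (hφ t t.2)
  · have h1 : eVariationOn γ Set.univ ≤ Real.toNNReal (K * |a - b|) *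
        eVariationOn (Subtype.val : unitInterval → ℝ) Set.univ :=
      hlip.comp_eVariationOn_le (fun t _ => t.2)
    have h2 : eVariationOn (Subtype.val : unitInterval → ℝ) Set.univ ≤ 1 := by
      have h3 : eVariationOn (id : ℝ → ℝ) (Set.Icc 0 1) ≤ 1 := by
        have := (monotoneOn_id (s := Set.Icc (0 : ℝ) 1)).eVariationOn_eq (a := 0) (b := 1)
          (by simp) (by simp)
        simp_all
      refine le_trans ?_ h3
      exact eVariationOn.comp_le_of_monotoneOn id (Subtype.val : unitInterval → ℝ)
        (fun _ _ _ _ h => h) (fun t _ => t.2)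
    refine h1.trans ((mul_le_mul_right h2 _).trans_eq ?_)
    rw [mul_one]
    rfl

theorem edist_le_of_mem_path {E : Type*} [PseudoEMetricSpace E] {x y : E} (γ : Path x y)
    (t : unitInterval) : edist x (γ t) ≤ eVariationOn γ Set.univ := by
  have := eVariationOn.edist_le γ (Set.mem_univ (0 : unitInterval)) (Set.mem_univ t)
  rwa [γ.source] at this

/-! ### The set is Lipschitz normally embedded -/

theorem exists_rotation_angle {u z u' z' r : ℝ} (hr : 0 < r) (h : u ^ 2 + z ^ 2 = r ^ 2)
    (h' : u' ^ 2 + z' ^ 2 = r ^ 2) : ∃ φ : ℝ, |φ| ≤ Real.pi ∧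
      u * Real.cos φ - z * Real.sin φ = u' ∧ u * Real.sin φ + z * Real.cos φ = z' := by
  -- The quotient `(u' + i z') / (u + i z)`, of modulus one; its principal argument selects a
  -- shortest arc.
  set w : ℂ := ⟨(u * u' + z * z') / r ^ 2, (u * z' - z * u') / r ^ 2⟩ with hw
  have hn : ‖w‖ = 1 := by
    rw [← sq_eq_sq₀ (norm_nonneg _) zero_le_one, Complex.sq_norm, Complex.normSq_apply]
    simp only [hw]
    field_simp
    linear_combination (u' ^ 2 + z' ^ 2) * h + r ^ 2 * h'
  have hw0 : w ≠ 0 := by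
    intro h0
    simp [h0] at hn
  refine ⟨w.arg, Complex.abs_arg_le_pi w, ?_, ?_⟩
  · rw [Complex.cos_arg hw0, Complex.sin_arg, hn]
    simp only [hw]
    field_simp
    linear_combination u' * h
  · rw [Complex.cos_arg hw0, Complex.sin_arg, hn]
    simp only [hw]
    field_simp
    linear_combination z' * h

/-- Two points of a circle in a horizontal plane are joined by an arc of it that is at most twice
as long as their distance. -/
theorem innerEDist_circle_le {X : Set E3} {c y r : ℝ} (hr : 0 < r)
    (hX : ∀ v : E3, v 1 = y → (v 0 - c) ^ 2 + v 2 ^ 2 = r ^ 2 → v ∈ X) {p q : E3}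
    (hp1 : p 1 = y) (hp : (p 0 - c) ^ 2 + p 2 ^ 2 = r ^ 2)
    (hq1 : q 1 = y) (hq : (q 0 - c) ^ 2 + q 2 ^ 2 = r ^ 2) :
    innerEDist X p q ≤ ENNReal.ofReal (2 * dist p q) := by
  obtain ⟨φ, hφ, h0, h2⟩ := exists_rotation_angle hr hp hq
  set f : ℝ → E3 := fun τ => !₂[c + ((p 0 - c) * Real.cos τ - p 2 * Real.sin τ), y,
    (p 0 - c) * Real.sin τ + p 2 * Real.cos τ] with hf
  have hf0 : f 0 = p := E3.ext (by simp [hf]) (by simp [hf, hp1]) (by simp [hf])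
  have hfφ : f φ = q := E3.ext (by simp [hf, h0]) (by simp [hf, hq1]) (by simp [hf, h2])
  have hdist : ∀ s t, dist (f s) (f t) ^ 2 = r ^ 2 * (2 - 2 * Real.cos (s - t)) := by
    intro s t
    rw [E3.dist_sq, Real.cos_sub, ← hp]
    simp only [hf, Matrix.cons_val]
    have hs := Real.sin_sq_add_cos_sq s
    have ht := Real.sin_sq_add_cos_sq t
    linear_combination ((p 0 - c) ^ 2 + p 2 ^ 2) * (hs + ht)
  have hlip : ∀ s t, dist (f s) (f t) ≤ r * |s - t| := by
    intro s t
    apply abs_le_of_sq_le_sq' _ (by positivity) |>.2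
    rw [hdist, mul_pow, sq_abs]
    have := Real.one_sub_sq_div_two_le_cos (x := s - t)
    exact mul_le_mul_of_nonneg_left (by linarith) (by positivity)
  have key := innerEDist_le_of_dist_le (X := X) (a := 0) (b := φ) f (fun s _ t _ => hlip s t) ?_
  · rw [hf0, hfφ] at key
    refine key.trans (ENNReal.ofReal_le_ofReal ?_)
    apply abs_le_of_sq_le_sq' _ (by positivity) |>.2
    have h1 := hdist 0 φ
    rw [hf0, hfφ] at h1
    rw [mul_pow 2, h1, mul_pow, sq_abs, zero_sub, Real.cos_neg]
    -- The squared chord is `r ^ 2 * (2 - 2 * cos φ)`. With `π ≤ 4` this is at least `(r * φ / 2) ^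
    -- 2`, whence the factor 2.
    have h3 := Real.cos_le_one_sub_mul_cos_sq hφ
    have h4 : 1 / 8 ≤ 2 / Real.pi ^ 2 := by
      rw [div_le_div_iff₀ (by norm_num) (by positivity)]
      nlinarith [Real.pi_le_four, Real.pi_pos]
    have h5 : 1 / 8 * φ ^ 2 ≤ 2 / Real.pi ^ 2 * φ ^ 2 :=
      mul_le_mul_of_nonneg_right h4 (sq_nonneg _)
    have h6 : (-φ) ^ 2 ≤ 2 ^ 2 * (2 - 2 * Real.cos φ) := by nlinarith
    nlinarith [mul_le_mul_of_nonneg_left h6 (sq_nonneg r)]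
  · intro t _
    refine hX _ (by simp [hf]) ?_
    simp only [hf, Matrix.cons_val]
    rw [← hp]
    linear_combination ((p 0 - c) ^ 2 + p 2 ^ 2) * Real.sin_sq_add_cos_sq t

theorem innerEDist_self_le {E : Type*} [PseudoMetricSpace E] {X : Set E} {x : E} (hx : x ∈ X) :
    innerEDist X x x = 0 := by
  have := innerEDist_le_of_dist_le (X := X) (a := 0) (b := 0) (K := 0) (fun _ => x) (by simp)
    (fun _ _ => hx)
  simpa using this

theorem innerEDist_le_add {E : Type*} [PseudoMetricSpace E] {X : Set E} {x y z : E} {a b c : ℝ}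
    (hxy : innerEDist X x y ≤ ENNReal.ofReal a) (hyz : innerEDist X y z ≤ ENNReal.ofReal b)
    (ha : 0 ≤ a) (hb : 0 ≤ b) (h : a + b ≤ c) : innerEDist X x z ≤ ENNReal.ofReal c :=
  (innerEDist_triangle X x y z).trans ((add_le_add hxy hyz).trans
    ((ENNReal.ofReal_add ha hb).symm.le.trans (ENNReal.ofReal_le_ofReal h)))

theorem hornForm_eq_zero_iff {s : ℝ} (hs : s ^ 2 = 1) (p : E3) : hornForm s p = 0 ↔
    (p 0 - s * (5 / 8 * p 1 ^ 2)) ^ 2 + p 2 ^ 2 = (3 / 8 * p 1 ^ 2) ^ 2 := by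
  have : (p 0 - s * (5 / 8 * p 1 ^ 2)) ^ 2 + p 2 ^ 2 - (3 / 8 * p 1 ^ 2) ^ 2 = hornForm s p := by
    unfold hornForm
    linear_combination (25 / 64 * p 1 ^ 4) * hs
  rw [← this, sub_eq_zero]

theorem mem_hornsWithWall_of_hornForm {s : ℝ} (hs : s ^ 2 = 1) {p : E3}
    (hp : p 1 ∈ Set.Icc (0 : ℝ) 1) (h : hornForm s p = 0) : p ∈ hornsWithWall := by
  rw [mem_hornsWithWall_iff]
  rcases sq_eq_one_iff.1 hs with rfl | rfl
  · exact ⟨hp, Or.inl h⟩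
  · exact ⟨hp, Or.inr (Or.inl h)⟩

theorem innerEDist_le_of_same_circle {s : ℝ} (hs : s ^ 2 = 1) {p q : E3} (hp0 : 0 < p 1)
    (hp1 : p 1 ≤ 1) (hpq : q 1 = p 1) (hp : hornForm s p = 0) (hq : hornForm s q = 0) :
    innerEDist hornsWithWall p q ≤ ENNReal.ofReal (2 * dist p q) := by
  rw [hornForm_eq_zero_iff hs] at hp hq
  rw [hpq] at hq
  refine innerEDist_circle_le (y := p 1) (by positivity) (fun v hv1 hv => ?_) rfl hp hpq hq
  rw [← hv1] at hv
  exact mem_hornsWithWall_of_hornForm hs ⟨by linarith, by linarith⟩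
    ((hornForm_eq_zero_iff hs v).2 hv)

theorem innerEDist_le_of_wall {p q : E3} (hp0 : 0 ≤ p 1) (hp1 : p 1 ≤ 1) (hpq : q 1 = p 1)
    (hp : p 2 = 0 ∧ |p 0| ≤ p 1 ^ 2 / 4) (hq : q 2 = 0 ∧ |q 0| ≤ q 1 ^ 2 / 4) :
    innerEDist hornsWithWall p q ≤ ENNReal.ofReal (dist p q) := by
  set f : ℝ → E3 := fun t => !₂[t, p 1, 0] with hf
  have hfp : f (p 0) = p := E3.ext (by simp [hf]) (by simp [hf]) (by simp [hf, hp.1])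
  have hfq : f (q 0) = q := E3.ext (by simp [hf]) (by simp [hf, hpq]) (by simp [hf, hq.1])
  have key := innerEDist_le_of_dist_le (X := hornsWithWall) (a := p 0) (b := q 0) (K := 1) f
    (fun s _ t _ => ?_) fun t ht => ?_
  · rw [hfp, hfq] at key
    refine key.trans (ENNReal.ofReal_le_ofReal ?_)
    rw [one_mul]
    exact E3.abs_sub_le_dist p q 0
  · simpa [hf] using E3.dist_le_add_abs (f s) (f t)
  · rw [mem_hornsWithWall_iff]
    refine ⟨⟨by simpa [hf], by simpa [hf]⟩, Or.inr (Or.inr ⟨by simp [hf], ?_⟩)⟩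
    rw [hpq] at hq
    have h1 := abs_le.1 hp.2
    have h2 := abs_le.1 hq.2
    simp only [hf, Matrix.cons_val]
    rw [abs_le]
    rcases Set.mem_uIcc.1 ht with h | h
    · exact ⟨by linarith, by linarith⟩
    · exact ⟨by linarith, by linarith⟩

/-- The path goes through the point `j` where wall and circle meet. As `j` separates the
`x`-coordinates of `p` and `q`, `dist j q ≤ dist p q`, so `dist p j ≤ 2 * dist p q`; arc and segment
give `2 * 2 + 1 = 5`. -/
theorem innerEDist_le_of_circle_of_wall {s : ℝ} (hs : s ^ 2 = 1) {p q : E3} (hp0 : 0 < p 1)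
    (hp1 : p 1 ≤ 1) (hpq : q 1 = p 1) (hp : hornForm s p = 0)
    (hq : q 2 = 0 ∧ |q 0| ≤ q 1 ^ 2 / 4) :
    innerEDist hornsWithWall p q ≤ ENNReal.ofReal (5 * dist p q) := by
  set j : E3 := !₂[s * (p 1 ^ 2 / 4), p 1, 0] with hj
  have hs' : |s| = 1 := by rwa [← sq_eq_sq₀ (abs_nonneg _) zero_le_one, sq_abs, one_pow]
  have hjq : dist j q ≤ dist p q := by
    apply E3.dist_le dist_nonneg
    rw [E3.dist_sq]
    simp only [hj, Matrix.cons_val, hpq, hq.1]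
    obtain ⟨h1, -, -⟩ := abs_le_sq_of_hornForm_nonpos hs hp.le
    have h2 : s * q 0 ≤ p 1 ^ 2 / 4 := by
      refine (le_abs_self _).trans ?_
      rw [abs_mul, hs', one_mul, ← hpq]
      exact hq.2
    have e1 : (s * (p 1 ^ 2 / 4) - q 0) ^ 2 = (p 1 ^ 2 / 4 - s * q 0) ^ 2 := by
      linear_combination ((p 1 ^ 2 / 4) ^ 2 - q 0 ^ 2) * hs
    have e2 : (p 0 - q 0) ^ 2 = (s * p 0 - s * q 0) ^ 2 := by
      linear_combination (-(p 0 - q 0) ^ 2) * hs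
    rw [e1, e2]
    have := pow_le_pow_left₀ (sub_nonneg.2 h2) (sub_le_sub_right h1 (s * q 0)) 2
    nlinarith [sq_nonneg (p 2)]
  have hpj : dist p j ≤ 2 * dist p q := by
    have := dist_triangle_right p j q
    linarith
  have hj1 : j 1 = p 1 := by simp [hj]
  refine innerEDist_le_add (a := 2 * dist p j) (b := dist j q)
    (innerEDist_le_of_same_circle hs hp0 hp1 hj1 hp ?_)
    (innerEDist_le_of_wall (by linarith) (by linarith) (by rw [hpq, hj1]) ⟨by simp [hj], ?_⟩ hq)
    (by positivity) (by positivity) (by linarith)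
  · simp only [hj, hornForm, Matrix.cons_val]
    linear_combination (-p 1 ^ 4 / 4) * hs
  · simp only [hj, Matrix.cons_val]
    rw [abs_mul, hs', one_mul, abs_of_nonneg (by positivity)]

/-- The circles are at least `y ^ 2 / 2` apart and have diameter `3 / 4 * y ^ 2`, so the detour
through the junction `j` is controlled: with `d = dist p q`, `dist p j ≤ 3 / 2 * d`, `dist j q ≤ 5 /
2 * d`, and `2 * (3 / 2) + 5 * (5 / 2) ≤ 16`. -/
theorem innerEDist_le_of_circle_of_circle {s : ℝ} (hs : s ^ 2 = 1) {p q : E3} (hp0 : 0 < p 1)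
    (hp1 : p 1 ≤ 1) (hpq : q 1 = p 1) (hp : hornForm s p = 0) (hq : hornForm (-s) q = 0) :
    innerEDist hornsWithWall p q ≤ ENNReal.ofReal (16 * dist p q) := by
  have hs' : |s| = 1 := by rwa [← sq_eq_sq₀ (abs_nonneg _) zero_le_one, sq_abs, one_pow]
  set j : E3 := !₂[s * (p 1 ^ 2 / 4), p 1, 0] with hj
  have hj1 : j 1 = p 1 := by simp [hj]
  have hj2 : j 2 = 0 ∧ |j 0| ≤ j 1 ^ 2 / 4 := by
    simp only [hj, Matrix.cons_val]
    rw [abs_mul, hs', one_mul, abs_of_nonneg (by positivity)]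
    exact ⟨trivial, le_rfl⟩
  have hpj' : hornForm s j = 0 := by
    simp only [hj, hornForm, Matrix.cons_val]
    linear_combination (-p 1 ^ 4 / 4) * hs
  have hpj : dist p j ≤ 3 / 4 * p 1 ^ 2 := by
    apply E3.dist_le (by positivity)
    simp only [hj, Matrix.cons_val]
    obtain ⟨h1, h2, -⟩ := abs_le_sq_of_hornForm_nonpos hs hp.le
    unfold hornForm at hp
    have e : (p 0 - s * (p 1 ^ 2 / 4)) ^ 2 + p 2 ^ 2 = 3 / 4 * p 1 ^ 2 * (s * p 0 - p 1 ^ 2 / 4) := by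
      linear_combination hp + (p 1 ^ 4 / 16) * hs
    nlinarith [sq_nonneg (p 1)]
  have hd : p 1 ^ 2 / 2 ≤ dist p q := by
    refine le_trans ?_ (E3.abs_sub_le_dist p q 0)
    obtain ⟨h1, -, -⟩ := abs_le_sq_of_hornForm_nonpos hs hp.le
    obtain ⟨h2, -, -⟩ := abs_le_sq_of_hornForm_nonpos (by rwa [neg_sq]) hq.le
    rw [hpq] at h2
    calc p 1 ^ 2 / 2 ≤ s * (p 0 - q 0) := by linarith
      _ ≤ |s * (p 0 - q 0)| := le_abs_self _
      _ = |p 0 - q 0| := by rw [abs_mul, hs', one_mul]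
  have hjq := dist_triangle_left j q p
  have h5 := innerEDist_le_of_circle_of_wall (by rwa [neg_sq]) (by linarith : 0 < q 1)
    (by linarith) (hj1.trans hpq.symm) hq hj2
  rw [innerEDist_comm, dist_comm] at h5
  have hsum : 2 * dist p j + 5 * dist j q ≤ 16 * dist p q := by
    have := dist_nonneg (x := p) (y := q)
    linarith
  exact innerEDist_le_add (innerEDist_le_of_same_circle hs hp0 hp1 hj1 hp hpj') h5
    (by positivity) (by positivity) hsum

theorem innerEDist_le_of_same_height {p q : E3} (hp : p ∈ hornsWithWall) (hq : q ∈ hornsWithWall)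
    (hpq : q 1 = p 1) : innerEDist hornsWithWall p q ≤ ENNReal.ofReal (16 * dist p q) := by
  rcases ((mem_hornsWithWall_iff p).1 hp).1.1.eq_or_lt with h0 | hp0
  · have hpp := abs_le_sq_of_mem_hornsWithWall hp
    have hqq := abs_le_sq_of_mem_hornsWithWall hq
    rw [hpq] at hqq
    rw [← h0] at hpp hqq
    simp only [ne_eq, OfNat.ofNat_ne_zero, not_false_eq_true, zero_pow, abs_nonpos_iff] at hpp hqq
    have : p = q := E3.ext (by rw [hpp.1, hqq.1]) hpq.symm (by rw [hpp.2, hqq.2])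
    rw [← this, innerEDist_self_le hp]
    exact zero_le
  · have hq0 : 0 < q 1 := by linarith
    have mono : ∀ {c : ℝ}, c ≤ 16 → innerEDist hornsWithWall p q ≤ ENNReal.ofReal (c * dist p q) →
        innerEDist hornsWithWall p q ≤ ENNReal.ofReal (16 * dist p q) := fun hc h =>
      h.trans (ENNReal.ofReal_le_ofReal (mul_le_mul_of_nonneg_right hc dist_nonneg))
    have h1 : (1 : ℝ) ^ 2 = 1 := one_pow 2
    have h2 : (-1 : ℝ) ^ 2 = 1 := by norm_num
    obtain ⟨⟨-, hp1⟩, hp | hp | hp⟩ := (mem_hornsWithWall_iff p).1 hp <;>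
    obtain ⟨⟨-, hq1⟩, hq | hq | hq⟩ := (mem_hornsWithWall_iff q).1 hq
    · exact mono (by norm_num) (innerEDist_le_of_same_circle h1 hp0 hp1 hpq hp hq)
    · exact innerEDist_le_of_circle_of_circle h1 hp0 hp1 hpq hp hq
    · exact mono (by norm_num) (innerEDist_le_of_circle_of_wall h1 hp0 hp1 hpq hp hq)
    · exact innerEDist_le_of_circle_of_circle h2 hp0 hp1 hpq hp (by rwa [neg_neg])
    · exact mono (by norm_num) (innerEDist_le_of_same_circle h2 hp0 hp1 hpq hp hq)
    · exact mono (by norm_num) (innerEDist_le_of_circle_of_wall h2 hp0 hp1 hpq hp hq)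
    · refine mono (c := 5) (by norm_num) ?_
      rw [innerEDist_comm, dist_comm]
      exact innerEDist_le_of_circle_of_wall h1 hq0 hq1 hpq.symm hq hp
    · refine mono (c := 5) (by norm_num) ?_
      rw [innerEDist_comm, dist_comm]
      exact innerEDist_le_of_circle_of_wall h2 hq0 hq1 hpq.symm hq hp
    · refine mono (c := 1) (by norm_num) ?_
      rw [one_mul]
      exact innerEDist_le_of_wall hp0.le hp1 hpq hp hq

/-- The point of height `t` on the parabola through `p` whose vertex is the origin. -/
noncomputable def slide (p : E3) (t : ℝ) : E3 :=
  !₂[p 0 / p 1 ^ 2 * t ^ 2, t, p 2 / p 1 ^ 2 * t ^ 2]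

theorem slide_mem_hornsWithWall {p : E3} (hp : p ∈ hornsWithWall) (hp0 : 0 < p 1) {t : ℝ}
    (ht : t ∈ Set.Icc (0 : ℝ) 1) : slide p t ∈ hornsWithWall := by
  -- Weighted homogeneity with scaling factor `t / p 1`.
  have hform : ∀ s, hornForm s (slide p t) = (t / p 1) ^ 4 * hornForm s p := by
    intro s
    simp only [hornForm, slide, Matrix.cons_val]
    field_simp
  rw [mem_hornsWithWall_iff] at hp ⊢
  refine ⟨by simpa [slide] using ht, ?_⟩
  rcases hp.2 with h | h | ⟨hz, h⟩
  · left; rw [hform, h, mul_zero]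
  · right; left; rw [hform, h, mul_zero]
  · right; right
    simp only [slide, Matrix.cons_val, hz]
    refine ⟨by simp, ?_⟩
    rw [abs_mul, abs_div, abs_of_nonneg (sq_nonneg (p 1)), abs_of_nonneg (sq_nonneg t)]
    have : |p 0| / p 1 ^ 2 ≤ 1 / 4 := by
      rw [div_le_iff₀ (by positivity)]; linarith
    nlinarith [mul_le_mul_of_nonneg_right this (sq_nonneg t)]

theorem dist_slide_le {p : E3} (hp : p ∈ hornsWithWall) (hp0 : 0 < p 1) {s t : ℝ}
    (hs : s ∈ Set.Icc (0 : ℝ) 1) (ht : t ∈ Set.Icc (0 : ℝ) 1) :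
    dist (slide p s) (slide p t) ≤ 5 * |s - t| := by
  refine (E3.dist_le_add_abs _ _).trans ?_
  simp only [slide, Matrix.cons_val]
  obtain ⟨h0, h2⟩ := abs_le_sq_of_mem_hornsWithWall hp
  have hsq : |s ^ 2 - t ^ 2| ≤ 2 * |s - t| := by
    rw [sq_sub_sq, abs_mul]
    refine mul_le_mul_of_nonneg_right ?_ (abs_nonneg _)
    rw [abs_of_nonneg (add_nonneg hs.1 ht.1)]
    linarith [hs.2, ht.2]
  have key : ∀ k : ℝ, |k| ≤ p 1 ^ 2 →
      |k / p 1 ^ 2 * s ^ 2 - k / p 1 ^ 2 * t ^ 2| ≤ 2 * |s - t| := by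
    intro k hk
    rw [← mul_sub, abs_mul, abs_div, abs_of_nonneg (sq_nonneg (p 1))]
    have : |k| / p 1 ^ 2 ≤ 1 := div_le_one_of_le₀ hk (by positivity)
    exact (mul_le_of_le_one_left (abs_nonneg _) this).trans hsq
  linarith [key _ h0, key _ h2]

theorem innerEDist_le_of_height_le {p q : E3} (hp : p ∈ hornsWithWall) (hq : q ∈ hornsWithWall)
    (hqp : q 1 ≤ p 1) : innerEDist hornsWithWall p q ≤ ENNReal.ofReal (101 * dist p q) := by
  have hpI := ((mem_hornsWithWall_iff p).1 hp).1
  have hqI := ((mem_hornsWithWall_iff q).1 hq).1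
  rcases hpI.1.eq_or_lt with h0 | hp0
  · refine (innerEDist_le_of_same_height hp hq (by linarith [hqI.1])).trans
      (ENNReal.ofReal_le_ofReal ?_)
    linarith [dist_nonneg (x := p) (y := q)]
  have hsub : Set.uIcc (p 1) (q 1) ⊆ Set.Icc 0 1 := Set.uIcc_subset_Icc hpI hqI
  have hp' : slide p (p 1) = p := by
    refine E3.ext ?_ ?_ ?_ <;> simp only [slide, Matrix.cons_val] <;> field_simp
  have h1 := innerEDist_le_of_dist_le (X := hornsWithWall) (a := p 1) (b := q 1) (slide p)
    (fun s hs t ht => dist_slide_le hp hp0 (hsub hs) (hsub ht))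
    (fun t ht => slide_mem_hornsWithWall hp hp0 (hsub ht))
  have h2 := innerEDist_le_of_same_height (slide_mem_hornsWithWall hp hp0 hqI) hq
    (by simp [slide])
  have h3 := dist_slide_le hp hp0 hpI hqI
  rw [hp'] at h1 h3
  have h4 := E3.abs_sub_le_dist p q 1
  have h5 := dist_triangle_left (slide p (q 1)) q p
  -- Sliding costs `5 * dist p q` and ends within `6 * dist p q` of `q`; `5 + 16 * 6 = 101`.
  exact innerEDist_le_add h1 h2 (by positivity) (by positivity) (by linarith)

theorem isLNE_hornsWithWall : IsLNE hornsWithWall := by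
  refine ⟨101, by norm_num, fun p hp q hq => ?_⟩
  rw [edist_dist, ← ENNReal.ofReal_mul (by norm_num)]
  rcases le_total (q 1) (p 1) with h | h
  · exact innerEDist_le_of_height_le hp hq h
  · rw [innerEDist_comm, dist_comm]
    exact innerEDist_le_of_height_le hq hp h

/-! ### Points of the medial axis inside the horns -/

theorem mem_medialAxis_of_ne {E : Type*} [PseudoMetricSpace E] {X : Set E} {p a b : E}
    (hp : p ∉ X) (ha : a ∈ X) (hb : b ∈ X) (hab : a ≠ b) (hda : dist a p = Metric.infDist p X)
    (hdb : dist b p = Metric.infDist p X) : p ∈ medialAxis X :=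
  ⟨hp, Set.one_lt_encard_iff.2 ⟨a, b, ⟨ha, hda⟩, ⟨hb, hdb⟩, hab⟩⟩

theorem notMem_of_hornForm_neg {p : E3} (h : hornForm 1 p < 0) : p ∉ hornsWithWall :=
  fun hp => h.not_ge (hornForm_one_nonneg hp)

/-- In every plane `y = y₀` with `0 < y₀ ≤ 1` the medial axis has a point inside the right horn. -/
theorem exists_mem_medialAxis_inside {y : ℝ} (hy0 : 0 < y) (hy1 : y ≤ 1) :
    ∃ p ∈ medialAxis hornsWithWall, p 1 = y ∧ hornForm 1 p < 0 := by
  have hc := E3.continuous_coord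
  have hXc := isClosed_hornsWithWall
  -- `X` is cut along the surface `x = 5 / 8 * y ^ 2` through the centres of the circles. On the
  -- diameter at height `y`, the intermediate value theorem yields a point equidistant from the two
  -- pieces.
  set A : Set E3 := hornsWithWall ∩ {q | q 0 ≤ 5 / 8 * q 1 ^ 2} with hA
  set B : Set E3 := hornsWithWall ∩ {q | 5 / 8 * q 1 ^ 2 ≤ q 0} with hB
  have hAc : IsClosed A := hXc.inter (isClosed_le (hc 0) (((hc 1).pow 2).const_mul _))
  have hBc : IsClosed B := hXc.inter (isClosed_le (((hc 1).pow 2).const_mul _) (hc 0))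
  set P : ℝ → E3 := fun x => !₂[x, y, 0] with hP
  have hPc : Continuous P := by fun_prop
  have hform : ∀ x, hornForm 1 (P x) = (x - y ^ 2) * (x - y ^ 2 / 4) := by
    intro x
    simp only [hornForm, hP, Matrix.cons_val]
    ring
  have hPX : ∀ x, (x - y ^ 2) * (x - y ^ 2 / 4) = 0 → P x ∈ hornsWithWall := fun x hx =>
    (mem_hornsWithWall_iff _).2 ⟨⟨by simpa [hP] using hy0.le, by simpa [hP]⟩,
      Or.inl ((hform x).trans hx)⟩
  have hl : P (y ^ 2 / 4) ∈ A := ⟨hPX _ (by ring), by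
    simp only [hP, Set.mem_ofPred_eq, Matrix.cons_val]; nlinarith⟩
  have hr : P (y ^ 2) ∈ B := ⟨hPX _ (by ring), by
    simp only [hP, Set.mem_ofPred_eq, Matrix.cons_val]; nlinarith⟩
  obtain ⟨x, ⟨hx0, hx1⟩, hx⟩ : ∃ x ∈ Set.Icc (y ^ 2 / 4) (y ^ 2),
      Metric.infDist (P x) A - Metric.infDist (P x) B = 0 := by
    refine intermediate_value_Icc (f := fun x => Metric.infDist (P x) A - Metric.infDist (P x) B)
      (by nlinarith) ?_ ⟨?_, ?_⟩
    · exact (((Metric.continuous_infDist_pt A).comp hPc).sub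
        ((Metric.continuous_infDist_pt B).comp hPc)).continuousOn
    · simp only [Metric.infDist_zero_of_mem hl, zero_sub, Left.neg_nonpos_iff]
      exact Metric.infDist_nonneg
    · simp only [Metric.infDist_zero_of_mem hr, sub_zero]
      exact Metric.infDist_nonneg
  obtain ⟨a, haA, ha⟩ := hAc.exists_infDist_eq_dist ⟨_, hl⟩ (P x)
  obtain ⟨b, hbB, hb⟩ := hBc.exists_infDist_eq_dist ⟨_, hr⟩ (P x)
  have hab : dist (P x) a = dist (P x) b := by rw [← ha, ← hb]; linarith
  have hda : dist a (P x) = Metric.infDist (P x) hornsWithWall := by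
    rw [dist_comm]
    refine le_antisymm ((Metric.le_infDist ⟨a, haA.1⟩).2 fun {q} hq => ?_)
      (Metric.infDist_le_dist_of_mem haA.1)
    rcases le_total (q 0) (5 / 8 * q 1 ^ 2) with h | h
    · rw [← ha]; exact Metric.infDist_le_dist_of_mem ⟨hq, h⟩
    · rw [hab, ← hb]; exact Metric.infDist_le_dist_of_mem ⟨hq, h⟩
  have hdb : dist b (P x) = Metric.infDist (P x) hornsWithWall := by
    rw [← hda, dist_comm, ← hab, dist_comm]
  have hd : dist (P x) a ≤ 3 / 4 * y ^ 2 := by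
    rw [dist_comm, hda]
    refine (Metric.infDist_le_dist_of_mem hr.1).trans (E3.dist_le (by positivity) ?_)
    simp only [hP, Matrix.cons_val]
    nlinarith
  have hneg : hornForm 1 (P x) < 0 := by
    have hne : ∀ q : E3, P x = q → q ∈ hornsWithWall → 0 < q 1 → q ∉ A ∩ B → False := by
      rintro _ rfl hq hq1 hn
      have h0 : Metric.infDist (P x) hornsWithWall = 0 := Metric.infDist_zero_of_mem hq
      rw [h0, dist_eq_zero] at hda hdb
      rw [hda] at haA
      rw [hdb] at hbB
      exact hn ⟨haA, hbB⟩
    rw [hform]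
    rcases hx0.eq_or_lt with rfl | hx0
    · refine (hne _ rfl hl.1 (by simpa [hP]) fun h => ?_).elim
      have := h.2.2
      simp only [hP, Set.mem_ofPred_eq, Matrix.cons_val] at this
      nlinarith
    rcases hx1.eq_or_lt with rfl | hx1
    · refine (hne _ rfl hr.1 (by simpa [hP]) fun h => ?_).elim
      have := h.1.2
      simp only [hP, Set.mem_ofPred_eq, Matrix.cons_val] at this
      nlinarith
    exact mul_neg_of_neg_of_pos (by linarith) (by linarith)
  refine ⟨P x, ?_, by simp [hP], hneg⟩
  have hPn := notMem_of_hornForm_neg hneg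
  -- A common closest point lies on the cutting surface. It is off the plane `z = 0`, where
  -- `hornForm 1` would be negative, so its reflection in that plane is a second closest point.
  by_cases hne : a = b
  · subst hne
    have ha0 : a 0 = 5 / 8 * a 1 ^ 2 := le_antisymm haA.2 hbB.2
    have ha1 : 0 < a 1 := by
      have := (abs_le.1 ((E3.abs_sub_le_dist (P x) a 1).trans hd)).2
      simp only [hP, Matrix.cons_val] at this
      nlinarith
    have ha2 : a 2 ≠ 0 := by
      intro ha2
      have := hornForm_one_nonneg haA.1
      rw [hornForm, ha0, ha2] at this
      nlinarith [pow_pos ha1 4]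
    have haX := (mem_hornsWithWall_iff a).1 haA.1
    have ha'X : (!₂[a 0, a 1, -a 2] : E3) ∈ hornsWithWall := by
      rw [mem_hornsWithWall_iff]
      refine ⟨by simpa using haX.1, ?_⟩
      simpa [hornForm] using haX.2
    refine mem_medialAxis_of_ne hPn haA.1 ha'X ?_ hda ?_
    · intro h
      have := congrArg (fun q : E3 => q 2) h
      simp only [Matrix.cons_val] at this
      exact ha2 (by linarith)
    · rw [← hda, ← sq_eq_sq₀ dist_nonneg dist_nonneg, E3.dist_sq, E3.dist_sq]
      simp [hP]
  · exact mem_medialAxis_of_ne hPn haA.1 hbB.1 hne hda hdb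

/-- The reflection `x ↦ -x`. -/
def reflectX (p : E3) : E3 := !₂[-p 0, p 1, p 2]

theorem isometry_reflectX : Isometry reflectX := by
  refine Isometry.of_dist_eq fun p q => ?_
  rw [← sq_eq_sq₀ dist_nonneg dist_nonneg, E3.dist_sq, E3.dist_sq]
  simp only [reflectX, Matrix.cons_val]
  ring

theorem reflectX_reflectX (p : E3) : reflectX (reflectX p) = p := by
  refine E3.ext ?_ ?_ ?_ <;> simp [reflectX]

theorem hornForm_reflectX (s : ℝ) (p : E3) : hornForm s (reflectX p) = hornForm (-s) p := by
  simp only [hornForm, reflectX, Matrix.cons_val]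
  ring

theorem reflectX_mem_hornsWithWall_iff (p : E3) :
    reflectX p ∈ hornsWithWall ↔ p ∈ hornsWithWall := by
  rw [mem_hornsWithWall_iff, mem_hornsWithWall_iff, hornForm_reflectX, hornForm_reflectX, neg_neg]
  simp only [reflectX, Matrix.cons_val, abs_neg]
  tauto

theorem reflectX_image_hornsWithWall : reflectX '' hornsWithWall = hornsWithWall := by
  ext p
  constructor
  · rintro ⟨q, hq, rfl⟩
    exact (reflectX_mem_hornsWithWall_iff q).2 hq
  · exact fun hp => ⟨reflectX p, (reflectX_mem_hornsWithWall_iff p).2 hp, reflectX_reflectX p⟩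

theorem reflectX_mem_medialAxis {p : E3} (hp : p ∈ medialAxis hornsWithWall) :
    reflectX p ∈ medialAxis hornsWithWall := by
  obtain ⟨a, b, ha, hb, hab⟩ := Set.one_lt_encard_iff.1 hp.2
  have hd : Metric.infDist (reflectX p) hornsWithWall = Metric.infDist p hornsWithWall := by
    conv_lhs => rw [← reflectX_image_hornsWithWall]
    exact Metric.infDist_image isometry_reflectX
  refine mem_medialAxis_of_ne (fun h => hp.1 ((reflectX_mem_hornsWithWall_iff p).1 h))
    ((reflectX_mem_hornsWithWall_iff a).2 ha.1) ((reflectX_mem_hornsWithWall_iff b).2 hb.1)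
    (isometry_reflectX.injective.ne hab) ?_ ?_
  · rw [isometry_reflectX.dist_eq, ha.2, hd]
  · rw [isometry_reflectX.dist_eq, hb.2, hd]

/-! ### The medial axis stays away from the horn -/

/-- A segment from inside the horn to a point where the form is positive crosses the horn earlier,
at a closer point of `X`. -/
theorem hornForm_eq_zero_of_closest {p b : E3} (hp1 : p 1 ∈ Set.Icc (0 : ℝ) 1)
    (hp : hornForm 1 p < 0) (hb : b ∈ closestPoints hornsWithWall p) : hornForm 1 b = 0 := by
  obtain ⟨hbX, hbd⟩ := hb
  by_contra hne
  have hbpos := (hornForm_one_nonneg hbX).lt_of_ne' hne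
  obtain ⟨t, ⟨ht0, ht1⟩, ht⟩ : ∃ t ∈ Set.Icc (0 : ℝ) 1,
      hornForm 1 (AffineMap.lineMap p b t) = 0 := by
    refine intermediate_value_Icc (f := fun t : ℝ => hornForm 1 (AffineMap.lineMap p b t))
      zero_le_one ?_ ⟨by simpa using hp.le, by simpa using hbpos.le⟩
    exact ((continuous_hornForm 1).comp AffineMap.lineMap_continuous).continuousOn
  have ht1 : t < 1 := by
    refine ht1.lt_of_ne fun h => hne ?_
    rwa [h, AffineMap.lineMap_apply_one] at ht
  have hb1 := ((mem_hornsWithWall_iff b).1 hbX).1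
  have hqX : AffineMap.lineMap p b t ∈ hornsWithWall := by
    refine (mem_hornsWithWall_iff _).2 ⟨?_, Or.inl ht⟩
    have : (AffineMap.lineMap p b t : E3) 1 = t * (b 1 - p 1) + p 1 := by
      simp [AffineMap.lineMap_apply]
    rw [this]
    constructor <;> nlinarith [hb1.1, hb1.2, hp1.1, hp1.2]
  have hd := Metric.infDist_le_dist_of_mem (x := p) hqX
  rw [← hbd, dist_comm p, dist_lineMap_left, Real.norm_of_nonneg ht0, dist_comm b p] at hd
  have hpb : 0 < dist p b := dist_pos.2 fun h => by rw [h] at hp; linarith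
  nlinarith

/-- The derivative of `hornForm 1`. -/
noncomputable def hornFormDeriv (b v : E3) : ℝ :=
  (2 * b 0 - 5 / 4 * b 1 ^ 2) * v 0 + (b 1 ^ 3 - 5 / 2 * b 0 * b 1) * v 1 + 2 * b 2 * v 2

/-- The segment from a point to a closest point on the horn is normal to the horn. -/
theorem exists_multiplier {p b : E3} (hb : b ∈ closestPoints hornsWithWall p) (hb0 : 0 < b 1)
    (hb1 : b 1 < 1) (hbF : hornForm 1 b = 0) : ∃ m : ℝ, ∀ v : E3,
      (p 0 - b 0) * v 0 + (p 1 - b 1) * v 1 + (p 2 - b 2) * v 2 = m * hornFormDeriv b v := by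
  have h : ∀ i : Fin 3, HasStrictFDerivAt (fun q : E3 => q i)
      (EuclideanSpace.proj (𝕜 := ℝ) i : E3 →L[ℝ] ℝ) b := fun i =>
    (EuclideanSpace.proj (𝕜 := ℝ) i).hasStrictFDerivAt
  have hF : HasStrictFDerivAt (hornForm 1)
      ((2 * b 0 - 5 / 4 * b 1 ^ 2) • (EuclideanSpace.proj (𝕜 := ℝ) (0 : Fin 3) : E3 →L[ℝ] ℝ) +
        (b 1 ^ 3 - 5 / 2 * b 0 * b 1) • (EuclideanSpace.proj (𝕜 := ℝ) (1 : Fin 3) : E3 →L[ℝ] ℝ) +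
        (2 * b 2) • (EuclideanSpace.proj (𝕜 := ℝ) (2 : Fin 3) : E3 →L[ℝ] ℝ)) b := by
    have h0 := ((((h 0).pow 2).add ((h 2).pow 2)).sub
      (((h 0).const_mul (5 / 4)).mul ((h 1).pow 2))).add (((h 1).pow 4).mul_const (1 / 4))
    refine (h0.congr_of_eventuallyEq (Filter.Eventually.of_forall fun q => ?_)).congr_fderiv ?_
    · simp only [hornForm, Pi.add_apply, Pi.sub_apply, Pi.mul_apply]
      ring
    · ext v
      simp
      ring
  have hφ : HasStrictFDerivAt (fun q : E3 => (q 0 - p 0) ^ 2 + (q 1 - p 1) ^ 2 + (q 2 - p 2) ^ 2)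
      ((2 * (b 0 - p 0)) • (EuclideanSpace.proj (𝕜 := ℝ) (0 : Fin 3) : E3 →L[ℝ] ℝ) +
        (2 * (b 1 - p 1)) • (EuclideanSpace.proj (𝕜 := ℝ) (1 : Fin 3) : E3 →L[ℝ] ℝ) +
        (2 * (b 2 - p 2)) • (EuclideanSpace.proj (𝕜 := ℝ) (2 : Fin 3) : E3 →L[ℝ] ℝ)) b := by
    have h0 := ((((h 0).sub_const (p 0)).pow 2).add (((h 1).sub_const (p 1)).pow 2)).add
      (((h 2).sub_const (p 2)).pow 2)
    refine (h0.congr_of_eventuallyEq (Filter.Eventually.of_forall fun q => rfl)).congr_fderiv ?_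
    ext v
    simp
  have hext : IsLocalExtrOn (fun q : E3 => (q 0 - p 0) ^ 2 + (q 1 - p 1) ^ 2 + (q 2 - p 2) ^ 2)
      {q | hornForm 1 q = hornForm 1 b} b := by
    left
    have hopen : {q : E3 | 0 < q 1 ∧ q 1 < 1} ∈ nhds b :=
      ((isOpen_lt continuous_const (E3.continuous_coord 1)).inter
        (isOpen_lt (E3.continuous_coord 1) continuous_const)).mem_nhds ⟨hb0, hb1⟩
    filter_upwards [mem_nhdsWithin_of_mem_nhds hopen, self_mem_nhdsWithin] with q hq hqF
    have hqX : q ∈ hornsWithWall :=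
      (mem_hornsWithWall_iff q).2 ⟨⟨hq.1.le, hq.2.le⟩, Or.inl (Eq.trans hqF hbF)⟩
    have := Metric.infDist_le_dist_of_mem (x := p) hqX
    rw [← hb.2, dist_comm p] at this
    have := pow_le_pow_left₀ dist_nonneg this 2
    rwa [E3.dist_sq, E3.dist_sq] at this
  obtain ⟨k, l, hkl, heq⟩ := hext.exists_multipliers_of_hasStrictFDerivAt_1d hF hφ
  have heq' : ∀ v : E3, k * hornFormDeriv b v + l * (2 * ((b 0 - p 0) * v 0 + (b 1 - p 1) * v 1 +
      (b 2 - p 2) * v 2)) = 0 := by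
    intro v
    have := congrArg (fun L : E3 →L[ℝ] ℝ => L v) heq
    simp only [add_apply, smul_apply, zero_apply, smul_eq_mul, PiLp.proj_apply] at this
    rw [hornFormDeriv]
    linarith
  -- The gradient of `hornForm 1` does not vanish on the horn: its `x`- and `z`-components are both
  -- zero only at the centres of the circles.
  have hl : l ≠ 0 := by
    rintro rfl
    have hk : k ≠ 0 := fun hk => hkl (by rw [hk]; rfl)
    have h0 := heq' !₂[1, 0, 0]
    have h2 := heq' !₂[0, 0, 1]
    simp [hornFormDeriv, hk] at h0 h2
    rw [hornForm_eq_zero_iff (by norm_num)] at hbF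
    have : 0 < b 1 ^ 2 := by positivity
    rw [h2] at hbF
    have : b 0 = 5 / 8 * b 1 ^ 2 := by linarith
    rw [this] at hbF
    nlinarith
  refine ⟨k / (2 * l), fun v => ?_⟩
  field_simp
  linarith [heq' v]

/-- The quadratic remainder of `hornForm 1` in the unit cube. -/
theorem abs_hornForm_remainder_le {x y X Y Z : ℝ} (hx0 : 0 ≤ x) (hx1 : x ≤ 1) (hy0 : 0 ≤ y)
    (hy1 : y ≤ 1) (hX : |X| ≤ 1) (hY : |Y| ≤ 1) :
    |-(X ^ 2 + Z ^ 2 - 5 / 4 * (x * Y ^ 2 + 2 * y * X * Y + X * Y ^ 2) +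
      1 / 4 * (6 * y ^ 2 + 4 * y * Y + Y ^ 2) * Y ^ 2)| ≤ 10 * (X ^ 2 + Y ^ 2 + Z ^ 2) := by
  have hY2 := sq_nonneg Y
  have t1 := mul_nonneg hx0 hY2
  have t1' := mul_le_mul_of_nonneg_right hx1 hY2
  have t2 : |2 * y * X * Y| ≤ X ^ 2 + Y ^ 2 := by
    refine abs_le.2 ⟨?_, ?_⟩
    · nlinarith [sq_nonneg (X + Y), sq_nonneg X, sq_nonneg Y,
        mul_nonneg hy0 (sq_nonneg (X + Y)), mul_nonneg (sub_nonneg.2 hy1) hY2,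
        mul_nonneg (sub_nonneg.2 hy1) (sq_nonneg X)]
    · nlinarith [sq_nonneg (X - Y), sq_nonneg X, sq_nonneg Y,
        mul_nonneg hy0 (sq_nonneg (X - Y)), mul_nonneg (sub_nonneg.2 hy1) hY2,
        mul_nonneg (sub_nonneg.2 hy1) (sq_nonneg X)]
  have t3 : |X * Y ^ 2| ≤ Y ^ 2 := by
    rw [abs_mul, abs_of_nonneg hY2]
    exact mul_le_of_le_one_left hY2 hX
  have t4 : |6 * y ^ 2 + 4 * y * Y + Y ^ 2| ≤ 11 := by
    have := abs_le.1 hY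
    exact abs_le.2 ⟨by nlinarith, by nlinarith⟩
  have t5 : |(6 * y ^ 2 + 4 * y * Y + Y ^ 2) * Y ^ 2| ≤ 11 * Y ^ 2 := by
    rw [abs_mul, abs_of_nonneg hY2]
    exact mul_le_mul_of_nonneg_right t4 hY2
  have s2 := abs_le.1 t2
  have s3 := abs_le.1 t3
  have s5 := abs_le.1 t5
  have hX2 := sq_nonneg X
  have hZ2 := sq_nonneg Z
  exact abs_le.2 ⟨by linarith, by linarith⟩

/-- A point with two closest points on the open part of the right horn is far from the horn. -/
theorem sq_le_infDist_of_closest_ne {p b b' : E3} (hb : b ∈ closestPoints hornsWithWall p)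
    (hb' : b' ∈ closestPoints hornsWithWall p) (hne : b ≠ b') (hbF : hornForm 1 b = 0)
    (hbF' : hornForm 1 b' = 0) (hb0 : 0 < b 1) (hb1 : b 1 < 1) :
    3 / 4 * b 1 ^ 2 ≤ 20 * Metric.infDist p hornsWithWall := by
  have hbI := ((mem_hornsWithWall_iff b).1 hb.1).1
  have hbI' := ((mem_hornsWithWall_iff b').1 hb'.1).1
  have hbx := (abs_le_sq_of_mem_hornsWithWall hb.1).1.trans (pow_le_one₀ hbI.1 hbI.2)
  have hbx' := (abs_le_sq_of_mem_hornsWithWall hb'.1).1.trans (pow_le_one₀ hbI'.1 hbI'.2)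
  obtain ⟨m, hm⟩ := exists_multiplier hb hb0 hb1 hbF
  have hxpos := (abs_le_sq_of_hornForm_nonpos (by norm_num) hbF.le).1
  have hxpos' := (abs_le_sq_of_hornForm_nonpos (by norm_num) hbF'.le).1
  set N : ℝ := (b' 0 - b 0) ^ 2 + (b' 1 - b 1) ^ 2 + (b' 2 - b 2) ^ 2 with hN
  have hNpos : 0 < N := by
    rw [hN, ← E3.dist_sq]
    have := dist_pos.2 hne.symm
    positivity
  -- The `x, z`-part of the gradient at `b` has length twice the radius, `3 / 4 * b 1 ^ 2`.
  have hmb : |m| * (3 / 4 * b 1 ^ 2) ≤ Metric.infDist p hornsWithWall := by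
    have h0 := hm !₂[1, 0, 0]
    have h2 := hm !₂[0, 0, 1]
    simp [hornFormDeriv] at h0 h2
    refine le_trans ?_ hb.2.le
    apply abs_le_of_sq_le_sq' _ dist_nonneg |>.2
    rw [dist_comm, E3.dist_sq, mul_pow, sq_abs, h0, h2]
    have hbF2 := (hornForm_eq_zero_iff (by norm_num) b).1 hbF
    have e : m ^ 2 * (3 / 4 * b 1 ^ 2) ^ 2 =
        (m * (2 * b 0 - 5 / 4 * b 1 ^ 2)) ^ 2 + (m * (2 * b 2)) ^ 2 := by
      linear_combination (-4 * m ^ 2) * hbF2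
    rw [e]
    linarith [sq_nonneg (b 1 - p 1)]
  -- Equidistance of `b` and `b'` from `p` reads `‖b' - b‖ ^ 2 = 2 * ⟪p - b, b' - b⟫`.
  have hNm : N = 2 * (m * hornFormDeriv b (b' - b)) := by
    have h1 : dist b p ^ 2 = dist b' p ^ 2 := by rw [hb.2, hb'.2]
    rw [E3.dist_sq, E3.dist_sq] at h1
    rw [← hm, hN]
    simp only [PiLp.sub_apply]
    linear_combination -h1
  -- The form vanishes at both points, so its linear term equals minus the Taylor remainder. This
  -- forces `1 ≤ 20 * |m|`.
  have hrem : |hornFormDeriv b (b' - b)| ≤ 10 * N := by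
    have e : hornFormDeriv b (b' - b) = -((b' 0 - b 0) ^ 2 + (b' 2 - b 2) ^ 2
        - 5 / 4 * (b 0 * (b' 1 - b 1) ^ 2 + 2 * b 1 * (b' 0 - b 0) * (b' 1 - b 1)
          + (b' 0 - b 0) * (b' 1 - b 1) ^ 2)
        + 1 / 4 * (6 * b 1 ^ 2 + 4 * b 1 * (b' 1 - b 1) + (b' 1 - b 1) ^ 2)
          * (b' 1 - b 1) ^ 2) := by
      unfold hornForm at hbF hbF'
      simp only [hornFormDeriv, PiLp.sub_apply]
      linear_combination hbF' - hbF
    have hb00 : 0 ≤ b 0 := by linarith [sq_nonneg (b 1)]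
    have hb00' : 0 ≤ b' 0 := by linarith [sq_nonneg (b' 1)]
    have hX : |b' 0 - b 0| ≤ 1 :=
      abs_le.2 ⟨by linarith [le_abs_self (b 0)], by linarith [le_abs_self (b' 0)]⟩
    have hY : |b' 1 - b 1| ≤ 1 :=
      abs_le.2 ⟨by linarith [hbI'.1], by linarith [hbI'.2]⟩
    rw [e]
    exact abs_hornForm_remainder_le hb00 (abs_le.1 hbx).2 hb0.le hb1.le hX hY
  have : N ≤ 20 * |m| * N := by
    calc N ≤ |2 * (m * hornFormDeriv b (b' - b))| := hNm.le.trans (le_abs_self _)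
      _ = 2 * |m| * |hornFormDeriv b (b' - b)| := by rw [abs_mul, abs_mul, abs_two, mul_assoc]
      _ ≤ 2 * |m| * (10 * N) := by gcongr
      _ = 20 * |m| * N := by ring
  have hm20 : 1 ≤ 20 * |m| := by
    by_contra! h
    nlinarith
  calc 3 / 4 * b 1 ^ 2 ≤ 20 * |m| * (3 / 4 * b 1 ^ 2) :=
        le_mul_of_one_le_left (by positivity) hm20
    _ ≤ 20 * Metric.infDist p hornsWithWall := by linarith

/-- Near a point of the right horn that is neither the origin nor on the upper rim, every point
inside the horn has only one closest point. -/
theorem dist_ge_of_mem_medialAxis_inside {a p : E3} (ha0 : 0 < a 1) (ha1 : a 1 < 1)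
    (ha : hornForm 1 a = 0) (hp1 : p 1 ∈ Set.Icc (0 : ℝ) 1) (hpF : hornForm 1 p < 0)
    (hp : p ∈ medialAxis hornsWithWall) : a 1 ^ 2 * (1 - a 1) / 200 ≤ dist p a := by
  by_contra! hlt
  obtain ⟨b, b', hb, hb', hne⟩ := Set.one_lt_encard_iff.1 hp.2
  have haX : a ∈ hornsWithWall := (mem_hornsWithWall_iff a).2 ⟨⟨ha0.le, ha1.le⟩, Or.inl ha⟩
  have hd : Metric.infDist p hornsWithWall ≤ dist p a := Metric.infDist_le_dist_of_mem haX
  have hsq1 : a 1 ^ 2 ≤ 1 := by nlinarith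
  have hsq2 : a 1 ^ 2 ≤ a 1 := by nlinarith
  have hsmall1 : a 1 ^ 2 * (1 - a 1) ≤ 1 - a 1 := by nlinarith
  have hsmall2 : a 1 ^ 2 * (1 - a 1) ≤ a 1 := by nlinarith
  have hsmall3 : a 1 ^ 2 * (1 - a 1) ≤ a 1 ^ 2 := by nlinarith
  -- Closest points lie within `2 * dist p a` of `a`, hence off the origin and the rim. At height at
  -- least `a 1 / 2`, the lower bound on the distance contradicts the constant 200.
  have hloc : ∀ c ∈ closestPoints hornsWithWall p, hornForm 1 c = 0 ∧ a 1 / 2 ≤ c 1 ∧ c 1 < 1 := by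
    intro c hc
    have h1 : dist c a ≤ dist p a + dist p a := by
      have := dist_triangle c p a
      have := hc.2
      linarith
    have h2 := abs_le.1 ((E3.abs_sub_le_dist c a 1).trans h1)
    have h3 : c 1 < 1 := by linarith
    have h4 : a 1 / 2 ≤ c 1 := by linarith
    exact ⟨hornForm_eq_zero_of_closest hp1 hpF hc, h4, h3⟩
  obtain ⟨hbF, hb0, hb1⟩ := hloc b hb
  have hbF' := (hloc b' hb').1
  have hkey := sq_le_infDist_of_closest_ne hb hb' hne hbF hbF' (by linarith) hb1
  have hbsq : (a 1 / 2) ^ 2 ≤ b 1 ^ 2 := pow_le_pow_left₀ (by positivity) hb0 2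
  nlinarith [pow_pos ha0 2]

/-! ### The medial axis is not Lipschitz normally embedded -/

/-- A path in the closure of the medial axis that leaves the inside of the right horn passes
through the origin or rises to the upper rim. -/
theorem exists_eq_zero_or_one_le_of_path {x y : E3} (γ : Path x y)
    (hγ : Set.range γ ⊆ closure (medialAxis hornsWithWall)) (hx0 : 0 < x 1)
    (hxF : hornForm 1 x < 0) (hy : 0 ≤ hornForm 1 y) :
    ∃ t, γ t = 0 ∨ 1 ≤ γ t 1 := by
  by_contra! hcon
  have hc := E3.continuous_coord 1
  set U : Set E3 := {p | 0 < p 1 ∧ p 1 < 1 ∧ hornForm 1 p < 0} with hU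
  have hUo : IsOpen U := (isOpen_lt continuous_const hc).inter
    ((isOpen_lt hc continuous_const).inter (isOpen_lt (continuous_hornForm 1) continuous_const))
  -- By connectedness of the interval it suffices that this open preimage is closed. A limit
  -- parameter outside it would give a horn point with `0 < y < 1` that inner medial axis points
  -- approach.
  have hclosed : IsClosed (γ ⁻¹' U) := by
    rw [← closure_subset_iff_isClosed]
    intro t ht
    have htU : γ t ∈ closure U := closure_mono (Set.image_preimage_subset γ U)
      (image_closure_subset_closure_image γ.continuous ⟨t, ht, rfl⟩)
    have hbig : closure U ⊆ {p | 0 ≤ p 1 ∧ hornForm 1 p ≤ 0} :=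
      closure_minimal (fun p hp => ⟨hp.1.le, hp.2.2.le⟩) ((isClosed_le continuous_const hc).inter
        (isClosed_le (continuous_hornForm 1) continuous_const))
    obtain ⟨h0, hF⟩ := hbig htU
    obtain ⟨hne, hlt⟩ := hcon t
    have hpos : 0 < γ t 1 := by
      refine h0.lt_of_ne fun h => hne ?_
      obtain ⟨h1, h2, h3⟩ := abs_le_sq_of_hornForm_nonpos (by norm_num) hF
      rw [← h] at h1 h2 h3
      exact E3.ext (by simp; linarith) (by simp [← h])
        (by simpa using pow_eq_zero_iff two_ne_zero |>.1 (le_antisymm (by simpa using h3)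
          (sq_nonneg (γ t 2))))
    refine ⟨hpos, hlt, hF.lt_of_ne fun hF0 => ?_⟩
    have hε : 0 < γ t 1 ^ 2 * (1 - γ t 1) / 200 := by
      have := sub_pos.2 hlt
      positivity
    obtain ⟨s, hsB, hsU⟩ := mem_closure_iff.1 ht _ (Metric.isOpen_ball.preimage γ.continuous)
      (Metric.mem_ball_self hε)
    obtain ⟨p, ⟨hpB, hpU⟩, hpM⟩ := mem_closure_iff.1 (hγ ⟨s, rfl⟩) _
      (Metric.isOpen_ball.inter hUo) ⟨hsB, hsU⟩
    exact (dist_ge_of_mem_medialAxis_inside hpos hlt hF0 ⟨hpU.1.le, hpU.2.1.le⟩ hpU.2.2 hpM).not_gt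
      hpB
  have huniv := IsClopen.eq_univ ⟨hclosed, hUo.preimage γ.continuous⟩
    ⟨0, by
      have := (hcon 0).2
      rw [γ.source] at this
      simpa [hU] using ⟨hx0, this, hxF⟩⟩
  have h1 : γ 1 ∈ U := by
    have := Set.mem_univ (1 : unitInterval)
    rwa [← huniv] at this
  rw [γ.target] at h1
  exact h1.2.2.not_ge hy

theorem le_innerEDist {S : Set E3} (hS : S ⊆ closure (medialAxis hornsWithWall)) {x y : E3}
    (hx0 : 0 < x 1) (hx1 : x 1 ≤ 1 / 2) (hxF : hornForm 1 x < 0) (hy : 0 ≤ hornForm 1 y) :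
    ENNReal.ofReal (x 1) ≤ innerEDist S x y := by
  refine le_iInf fun γ => le_iInf fun hγ => le_iInf fun _ => ?_
  obtain ⟨t, ht⟩ := exists_eq_zero_or_one_le_of_path γ (hγ.trans hS) hx0 hxF hy
  refine le_trans ?_ (edist_le_of_mem_path γ t)
  rw [edist_dist]
  refine ENNReal.ofReal_le_ofReal (le_trans ?_ (E3.abs_sub_le_dist x (γ t) 1))
  rcases ht with h | h
  · rw [h]
    simpa using le_abs_self (x 1)
  · rw [abs_sub_comm]
    exact le_trans (by linarith) (le_abs_self _)

theorem norm_le_of_hornForm_neg {s : ℝ} (hs : s ^ 2 = 1) {p : E3} (hp : p 1 ∈ Set.Icc (0 : ℝ) 1)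
    (h : hornForm s p < 0) : |p 0| ≤ p 1 ^ 2 ∧ |p 2| ≤ p 1 ^ 2 ∧ ‖p‖ ≤ 3 * p 1 := by
  obtain ⟨h1, h2, h3⟩ := abs_le_sq_of_hornForm_nonpos hs h.le
  have hs' : |s| = 1 := by rwa [← sq_eq_sq₀ (abs_nonneg _) zero_le_one, sq_abs, one_pow]
  have hsq := sq_nonneg (p 1)
  have hx : |p 0| ≤ p 1 ^ 2 := by
    rw [← one_mul |p 0|, ← hs', ← abs_mul]
    exact abs_le.2 ⟨by linarith, h2⟩
  have hz : |p 2| ≤ p 1 ^ 2 :=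
    (abs_le_of_sq_le_sq h3 (by positivity)).trans (by linarith)
  refine ⟨hx, hz, ?_⟩
  have hd := E3.dist_le_add_abs p 0
  have hy : p 1 ^ 2 ≤ p 1 := by nlinarith [hp.1, hp.2]
  simp only [dist_zero_right, PiLp.zero_apply, sub_zero, abs_of_nonneg hp.1] at hd
  linarith

/-- The two inclusions cover the medial axis, its closure and the local versions at once. -/
theorem not_isLNE_of_subset_closure {S : Set E3} (hS : S ⊆ closure (medialAxis hornsWithWall))
    {r : ℝ} (hr : 0 < r) (hrS : medialAxis hornsWithWall ∩ Metric.ball 0 r ⊆ S) : ¬ IsLNE S := by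
  rintro ⟨C, hC, hLNE⟩
  -- The bound `r / 4` keeps the points in the ball, as their norms are at most `3 * y`; `1 / (4 *
  -- C)` contradicts `y ≤ C * (2 * y ^ 2)`.
  set y : ℝ := min (1 / 2) (min (r / 4) (1 / (4 * C))) with hy
  have hy0 : 0 < y := by positivity
  have hy1 : y ≤ 1 / 2 := min_le_left _ _
  have hyr : y ≤ r / 4 := (min_le_right _ _).trans (min_le_left _ _)
  have hyC : y ≤ 1 / (4 * C) := (min_le_right _ _).trans (min_le_right _ _)
  obtain ⟨p, hpM, hpy, hpF⟩ := exists_mem_medialAxis_inside hy0 (by linarith)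
  have hpI : p 1 ∈ Set.Icc (0 : ℝ) 1 := by rw [hpy]; exact ⟨hy0.le, by linarith⟩
  obtain ⟨hx, hz, hn⟩ := norm_le_of_hornForm_neg (by norm_num) hpI hpF
  have hqn : ‖reflectX p‖ = ‖p‖ := by
    rw [← sq_eq_sq₀ (norm_nonneg _) (norm_nonneg _), E3.norm_sq, E3.norm_sq]
    simp [reflectX]
  have hpS : p ∈ S := hrS ⟨hpM, by rw [mem_ball_zero_iff]; linarith⟩
  have hqS : reflectX p ∈ S :=
    hrS ⟨reflectX_mem_medialAxis hpM, by rw [mem_ball_zero_iff]; linarith⟩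
  have hqF : 0 ≤ hornForm 1 (reflectX p) := by
    have h0 := (abs_le_sq_of_hornForm_nonpos (by norm_num) hpF.le).1
    have : 0 ≤ p 0 := by linarith [sq_nonneg (p 1)]
    rw [hornForm_reflectX, hornForm]
    have := mul_nonneg this (sq_nonneg (p 1))
    nlinarith [sq_nonneg (p 0), sq_nonneg (p 2), pow_nonneg hpI.1 4]
  have h1 := (le_innerEDist hS (by linarith) (by linarith) hpF hqF).trans (hLNE p hpS _ hqS)
  rw [edist_dist, ← ENNReal.ofReal_mul hC.le, ENNReal.ofReal_le_ofReal_iff (by positivity)] at h1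
  have hd : dist p (reflectX p) ≤ 2 * y ^ 2 := by
    refine (E3.dist_le_add_abs _ _).trans ?_
    simp only [reflectX, Matrix.cons_val, sub_neg_eq_add, sub_self, abs_zero, add_zero]
    rw [← two_mul, abs_mul, abs_two, ← hpy]
    linarith
  rw [hpy] at h1
  have h2 : y * (4 * C) ≤ 1 := (le_div_iff₀ (by positivity)).1 hyC
  nlinarith [mul_le_mul_of_nonneg_left hd hC.le]

/-! ### The two parts inside the horns -/

theorem zero_mem_closure_inside : (0 : E3) ∈ closure (medialAxis hornsWithWall ∩
    hornInside gamma11 gamma12) := by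
  rw [Metric.mem_closure_iff]
  intro ε hε
  have hy0 : 0 < min 1 (ε / 4) := by positivity
  obtain ⟨p, hpM, hpy, hpF⟩ := exists_mem_medialAxis_inside hy0 (min_le_left _ _)
  have hpI : p 1 ∈ Set.Icc (0 : ℝ) 1 := by rw [hpy]; exact ⟨hy0.le, min_le_left _ _⟩
  refine ⟨p, ⟨hpM, (mem_hornInside_right_iff p).2 ⟨hpI, hpF⟩⟩, ?_⟩
  have := (norm_le_of_hornForm_neg (by norm_num) hpI hpF).2.2
  rw [dist_zero_left]
  linarith [min_le_right 1 (ε / 4)]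

theorem reflectX_image_inside_subset :
    reflectX '' (medialAxis hornsWithWall ∩ hornInside gamma11 gamma12) ⊆
      medialAxis hornsWithWall ∩ hornInside gamma21 gamma22 := by
  rintro _ ⟨p, ⟨hpM, hp⟩, rfl⟩
  refine ⟨reflectX_mem_medialAxis hpM, ?_⟩
  rw [mem_hornInside_left_iff, hornForm_reflectX, neg_neg]
  simpa [reflectX] using (mem_hornInside_right_iff p).1 hp

theorem closure_inside_inter_closure_inside :
    closure (medialAxis hornsWithWall ∩ hornInside gamma11 gamma12) ∩
      closure (medialAxis hornsWithWall ∩ hornInside gamma21 gamma22) = {0} := by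
  have hsub : ∀ {s : ℝ} {M : Set E3}, (∀ p ∈ M, hornForm s p ≤ 0) →
      ∀ p ∈ closure M, hornForm s p ≤ 0 := fun {s M} h p hp =>
    closure_minimal (t := {p | hornForm s p ≤ 0}) h
      (isClosed_le (continuous_hornForm s) continuous_const) hp
  apply Set.Subset.antisymm
  · rintro p ⟨hp, hp'⟩
    have h1 := hsub (s := 1) (fun q hq => ((mem_hornInside_right_iff q).1 hq.2).2.le) p hp
    have h2 := hsub (s := -1) (fun q hq => ((mem_hornInside_left_iff q).1 hq.2).2.le) p hp'
    obtain ⟨h3, h4, h5⟩ := abs_le_sq_of_hornForm_nonpos (by norm_num) h1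
    obtain ⟨h6, -, -⟩ := abs_le_sq_of_hornForm_nonpos (by norm_num) h2
    -- Both `p 0` and `-p 0` are at least `p 1 ^ 2 / 4`.
    have hy : p 1 ^ 2 = 0 := le_antisymm (by linarith) (sq_nonneg _)
    rw [hy] at h3 h4 h5 h6
    have hz : p 2 ^ 2 = 0 := le_antisymm (by simpa using h5) (sq_nonneg _)
    exact E3.ext (by simp; linarith) (by simpa using hy) (by simpa using hz)
  · rintro _ rfl
    refine ⟨zero_mem_closure_inside, closure_mono reflectX_image_inside_subset ?_⟩
    refine image_closure_subset_closure_image isometry_reflectX.continuous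
      ⟨0, zero_mem_closure_inside, ?_⟩
    exact E3.ext (by simp [reflectX]) (by simp [reflectX]) (by simp [reflectX])

/-- The insides of the horns are tangent to each other to order two at the origin. -/
theorem dist_le_of_mem_insides {p q : E3} (hp : p ∈ hornInside gamma11 gamma12)
    (hq : q ∈ hornInside gamma21 gamma22) (hpq : ‖p‖ = ‖q‖) : dist p q ≤ 6 * ‖p‖ ^ 2 := by
  obtain ⟨hpI, hpF⟩ := (mem_hornInside_right_iff p).1 hp
  obtain ⟨hqI, hqF⟩ := (mem_hornInside_left_iff q).1 hq
  obtain ⟨hp0, hp2, -⟩ := norm_le_of_hornForm_neg (by norm_num) hpI hpF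
  obtain ⟨hq0, hq2, -⟩ := norm_le_of_hornForm_neg (by norm_num) hqI hqF
  have hn : ∀ v : E3, v 1 ^ 2 ≤ ‖v‖ ^ 2 := fun v => by
    rw [E3.norm_sq]; nlinarith [sq_nonneg (v 0), sq_nonneg (v 2)]
  have hnp := hn p
  have hnq := hn q
  rw [← hpq] at hnq
  set N := ‖p‖ ^ 2 with hN
  have hN0 : 0 ≤ N := by positivity
  -- Equal norms make `p 1 ^ 2` and `q 1 ^ 2` differ only through the `x, z`-terms, by at most `2 *
  -- N ^ 2`; for nonnegative heights this dominates `(p 1 - q 1) ^ 2`.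
  have h1 : |p 1 - q 1| ≤ 2 * N := by
    apply abs_le_of_sq_le_sq _ (by positivity)
    have ep := E3.norm_sq p
    have eq := E3.norm_sq q
    rw [← hpq] at eq
    have b : ∀ {c : ℝ}, |c| ≤ N → c ^ 2 ≤ N ^ 2 := fun hc => by
      rw [← sq_abs]
      exact pow_le_pow_left₀ (abs_nonneg _) hc 2
    have b1 := b (hp0.trans hnp)
    have b2 := b (hp2.trans hnp)
    have b3 := b (hq0.trans hnq)
    have b4 := b (hq2.trans hnq)
    have h2 : |p 1 ^ 2 - q 1 ^ 2| ≤ 2 * N ^ 2 := abs_le.2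
      ⟨by nlinarith [sq_nonneg (q 0), sq_nonneg (q 2)],
        by nlinarith [sq_nonneg (p 0), sq_nonneg (p 2)]⟩
    have h3 : (p 1 - q 1) ^ 2 ≤ |p 1 ^ 2 - q 1 ^ 2| := by
      rw [sq_sub_sq, abs_mul, ← sq_abs, sq]
      refine mul_le_mul_of_nonneg_right ?_ (abs_nonneg _)
      rw [abs_of_nonneg (add_nonneg hpI.1 hqI.1)]
      exact abs_le.2 ⟨by linarith [hpI.1], by linarith [hqI.1]⟩
    nlinarith [sq_nonneg N]
  refine (E3.dist_le_add_abs p q).trans ?_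
  have h0 := abs_sub (p 0) (q 0)
  have h2 := abs_sub (p 2) (q 2)
  linarith

theorem mainTheorem2 :
    IsLNE hornsWithWall ∧
    ¬ IsLNE (medialAxis hornsWithWall) ∧
    ¬ IsLNE (closure (medialAxis hornsWithWall)) ∧
    (∀ r : ℝ, 0 < r → ¬ IsLNE (closure (medialAxis hornsWithWall) ∩ Metric.ball (0 : E3) r)) ∧
    closure (medialAxis hornsWithWall ∩ hornInside gamma11 gamma12) ∩
      closure (medialAxis hornsWithWall ∩ hornInside gamma21 gamma22) = {0} ∧
    (∃ α : ℝ, 1 < α ∧ ∃ C : ℝ, 0 < C ∧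
      ∀ p ∈ medialAxis hornsWithWall ∩ hornInside gamma11 gamma12,
      ∀ q ∈ medialAxis hornsWithWall ∩ hornInside gamma21 gamma22,
        ‖p‖ = ‖q‖ → dist p q ≤ C * ‖p‖ ^ α) := by
  refine ⟨isLNE_hornsWithWall,
    not_isLNE_of_subset_closure subset_closure one_pos Set.inter_subset_left,
    not_isLNE_of_subset_closure subset_rfl one_pos (Set.inter_subset_left.trans subset_closure),
    fun r hr => not_isLNE_of_subset_closure Set.inter_subset_left hr
      (Set.inter_subset_inter_left _ subset_closure),
    closure_inside_inter_closure_inside, 2, one_lt_two, 6, by norm_num, fun p hp q hq hpq => ?_⟩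
  rw [Real.rpow_two]
  exact dist_le_of_mem_insides hp.2 hq.2 hpq
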